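/- Let $\omega,\sigma\in\mathbb R$ with $\sigma>0$ and $-\infty\le a<b\le\infty$. For $s=1,2$ let $X^s=H^s(0,1)\times H^s(0,1)\times\mathbb R\times\mathbb R$, with elements $(\varphi,\theta,z,\eta)$. For such elements (with $\eta>-1$) put $$\tilde z=z+\int_0^1\frac{y\,\varphi_y\,(\theta_y+\omega(1-y)-1)}{\eta+1}\,dy .$$ Let $N^{\omega,\sigma}$ be the set of all $(\varphi,\theta,z,\eta)\in X^2$ with $\int_0^1\varphi\,dy=0$, $\theta(0)=\theta(1)=0$, $|\tilde z|<\sigma$ and $\eta>-1$, and let $\mathcal D\subset N^{\omega,\sigma}$ be the set of those elements that also satisfy $$\varphi_y(0)=0,\qquad \varphi_y(1)=\frac{\tilde z\,(\theta_y(1)-1)}{\sqrt{\sigma^2-\tilde z^2}} .$$ Let $\gamma\in C^1((a,b),N^{\omega,\sigma})$ (with the $X^2$ norm), $\gamma(x)=(\varphi(x,\cdot),\theta(x,\cdot),z(x),\eta(x))$, satisfy $\gamma(x)\in\mathcal D$ for all $x\in(a,b)$ and solve Hamilton's equations $$\begin{aligned} \dot\varphi&=\frac1{\eta+1}\Big(\theta_y+\frac{\tilde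 z\,(y\varphi_y-\varphi(1))}{\sqrt{\sigma^2-\tilde z^2}}\Big)+\omega(\eta+1)\big(y-\tfrac12\big)-\frac{\omega}{\eta+1}\big(y-\tfrac12\big),\\ \dot\theta&=\frac1{\eta+1}\Big(\frac{\tilde z\,y\,(\theta_y+\omega(1-y)-1)}{\sqrt{\sigma^2-\tilde z^2}}-\varphi_y\Big),\\ \dot z&=\int_0^1\Big(\frac{(\theta_y+\omega(1-y)-1)^2-\varphi_y^2}{2(\eta+1)^2}-\frac12\Big)dy+\frac{\tilde z}{\sqrt{\sigma^2-\tilde z^2}}\int_0^1\frac{y\varphi_y(\theta_y+\omega(1-y)-1)}{(\eta+1)^2}\,dy-\int_0^1\omega y\,(\theta_y+\omega(1-y)-1)\,dy,\\ \dot\eta&=\frac{\tilde z}{\sqrt{\sigma^2-\tilde z^2}} . \end{aligned}$$ Then, with $\varphi(x,\cdot)$ and $\theta(x,\cdot)$ denoting the absolutely continuous representatives on $[0,1]$, the functions $\varphi,\theta$ are continuous on $(a,b)\times[0,1]$, and the following holds for all $x_1,x_2$ with $a<x_1<x_2<b$. Let $\Theta=\{(x,y):x_1<x<x_2,\ -1<y<\eta(x)\}$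 and, for $(x,y)\in\Theta$ and $\bar y=(y+1)/(\eta(x)+1)$, let $$\phi(x,y)=\varphi(x,\bar y)+\frac{2-\omega}2(x-x_1)+\int_{x_1}^x\Big(\frac{\eta_x(s)}{\eta(s)+1}\varphi(s,1)+\frac\omega2\eta(s)+\frac{\omega-2}{2(\eta(s)+1)}\Big)ds,$$ $$\zeta(x,y)=\theta(x,\bar y)-\frac\omega2(1-\bar y)^2+\bar y\,\eta(x).$$ Then $\phi,\zeta\in H^2(\Theta)\cap C^\infty(\Theta)$ and $$\phi_x=\zeta_y+\omega y,\qquad \phi_y=-\zeta_x\qquad\text{in }\Theta .$$ Moreover $\eta\in C^2(x_1,x_2)$, the derivatives $\phi_x,\phi_y$ extend continuously to $\{x_1<x<x_2,\ -1\le y\le\eta(x)\}$, and $\phi,\eta$ solve the travelling-wave problem $$\begin{aligned} &\phi_{xx}+\phi_{yy}=0 &&\text{in }\Theta,\\ &\phi_y=0 &&\text{on }y=-1,\\ &-\eta_x=\phi_y-(\phi_x-\omega\eta)\,\eta_x &&\text{on }y=\eta(x),\\ &-\phi_x+\tfrac12\phi_x^2+\tfrac12\phi_y^2-\omega\eta\,\phi_x+\omega\eta+\tfrac{\omega^2}2\eta^2-\frac{\sigma\,\eta_{xx}}{(1+\eta_x^2)^{3/2}}=0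 &&\text{on }y=\eta(x), \end{aligned}$$ for $x_1<x<x_2$. -/

import Mathlib

open MeasureTheory Set

noncomputable section

namespace CapillaryWave

/-! ### Test functions and weak derivatives -/

/-- Smooth real functions whose compact support lies in `U`. -/
def IsTest {E : Type*} [NormedAddCommGroup E] [NormedSpace ℝ E] (U : Set E) (ψ : E → ℝ) : Prop :=
  ContDiff ℝ (⊤ : ℕ∞) ψ ∧ HasCompactSupport ψ ∧ tsupport ψ ⊆ U

/-- Lebesgue measure on `(0,1)`. -/
abbrev vol01 : Measure ℝ := volume.restrict (Ioo (0 : ℝ) 1)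

/-- `L²(0,1)`. -/
abbrev L2 : Type := Lp ℝ 2 vol01

/-- `v` is the weak derivative of `u` on `(0,1)`. -/
def IsWeakDeriv (u v : L2) : Prop :=
  ∀ ψ : ℝ → ℝ, IsTest (Ioo (0 : ℝ) 1) ψ →
    ∫ y, u y * deriv ψ y ∂vol01 = -∫ y, v y * ψ y ∂vol01

theorem IsTest.integrable_mul {ψ : ℝ → ℝ} (h : IsTest (Ioo (0 : ℝ) 1) ψ) (u : L2) :
    Integrable (fun y => u y * ψ y) vol01 :=
  MemLp.integrable_mul (q := 2) (Lp.memLp u)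
    (h.1.continuous.memLp_of_hasCompactSupport h.2.1)

theorem IsTest.integrable_mul_deriv {ψ : ℝ → ℝ} (h : IsTest (Ioo (0 : ℝ) 1) ψ) (u : L2) :
    Integrable (fun y => u y * deriv ψ y) vol01 :=
  MemLp.integrable_mul (q := 2) (Lp.memLp u)
    ((h.1.continuous_deriv (by simp)).memLp_of_hasCompactSupport h.2.1.deriv)

theorem IsWeakDeriv.zero : IsWeakDeriv 0 0 := by
  intro ψ _
  have h0 : ((0 : L2) : ℝ → ℝ) =ᵐ[vol01] 0 := Lp.coeFn_zero ℝ 2 vol01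
  have h1 : ∀ f : ℝ → ℝ, ∫ y, (0 : L2) y * f y ∂vol01 = 0 := fun f =>
    integral_eq_zero_of_ae (h0.mono fun y hy => by
      change (0 : L2) y * f y = 0
      rw [hy]; simp)
  rw [h1, h1, neg_zero]

theorem IsWeakDeriv.add {u v u' v' : L2} (h : IsWeakDeriv u v) (h' : IsWeakDeriv u' v') :
    IsWeakDeriv (u + u') (v + v') := by
  intro ψ hψ
  have h1 : ∀ (w w' : L2) (f : ℝ → ℝ), ∫ y, (w + w' : L2) y * f y ∂vol01
      = ∫ y, (w y * f y + w' y * f y) ∂vol01 := fun w w' f =>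
    integral_congr_ae ((Lp.coeFn_add w w').mono fun y hy => by
      change (w + w' : L2) y * f y = _
      rw [hy, Pi.add_apply, add_mul])
  rw [h1, h1,
    integral_add (hψ.integrable_mul_deriv u) (hψ.integrable_mul_deriv u'),
    integral_add (hψ.integrable_mul v) (hψ.integrable_mul v'), h ψ hψ, h' ψ hψ]
  ring

theorem IsWeakDeriv.smul (c : ℝ) {u v : L2} (h : IsWeakDeriv u v) :
    IsWeakDeriv (c • u) (c • v) := by
  intro ψ hψ
  have h1 : ∀ (w : L2) (f : ℝ → ℝ), ∫ y, (c • w : L2) y * f y ∂vol01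
      = ∫ y, c * (w y * f y) ∂vol01 := fun w f =>
    integral_congr_ae ((Lp.coeFn_smul c w).mono fun y hy => by
      change (c • w : L2) y * f y = _
      rw [hy, Pi.smul_apply, smul_eq_mul, mul_assoc])
  rw [h1, h1,
    integral_const_mul, integral_const_mul, h ψ hψ]
  ring

/-! ### The spaces `H¹(0,1)`, `H²(0,1)`, `X¹`, `X²`

An element of `Hˢ(0,1)` is stored together with its (unique) weak derivatives; the norm inherited
from the product of `L²` spaces is equivalent to the usual one, and likewise for `Xˢ`. -/

/-- Pairs `(u, u_y)` in `L²`. -/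
def H1Submodule : Submodule ℝ (L2 × L2) where
  carrier := {p | IsWeakDeriv p.1 p.2}
  zero_mem' := IsWeakDeriv.zero
  add_mem' := fun h h' => IsWeakDeriv.add h h'
  smul_mem' := fun c _ h => IsWeakDeriv.smul c h

/-- `H¹(0,1)`. -/
abbrev H1 : Type := H1Submodule

/-- Triples `(u, u_y, u_yy)` in `L²`. -/
def H2Submodule : Submodule ℝ (L2 × L2 × L2) where
  carrier := {p | IsWeakDeriv p.1 p.2.1 ∧ IsWeakDeriv p.2.1 p.2.2}
  zero_mem' := ⟨IsWeakDeriv.zero, IsWeakDeriv.zero⟩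
  add_mem' := fun h h' => ⟨h.1.add h'.1, h.2.add h'.2⟩
  smul_mem' := fun c _ h => ⟨h.1.smul c, h.2.smul c⟩

/-- `H²(0,1)`. -/
abbrev H2 : Type := H2Submodule

/-- The function `u`, as an element of `L²`. -/
def H1.val (u : H1) : L2 := u.1.1

/-- The weak derivative `u_y`. -/
def H1.der (u : H1) : L2 := u.1.2

/-- The inclusion `H²(0,1) ⊆ H¹(0,1)`. -/
def H2.toH1 (u : H2) : H1 := ⟨(u.1.1, u.1.2.1), u.2.1⟩

/-- The weak derivative `u_y ∈ H¹(0,1)` of `u ∈ H²(0,1)`. -/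
def H2.derH1 (u : H2) : H1 := ⟨(u.1.2.1, u.1.2.2), u.2.2⟩

/-- The trace `u(0)`. -/
def trace0 (u : H1) : ℝ := -(∫ y, (1 - y) * u.der y ∂vol01) + ∫ y, u.val y ∂vol01

/-- The trace `u(1)`. -/
def trace1 (u : H1) : ℝ := (∫ y, y * u.der y ∂vol01) + ∫ y, u.val y ∂vol01

/-- The absolutely continuous representative of `u ∈ H¹(0,1)` on `[0,1]`. -/
def rep (u : H1) (y : ℝ) : ℝ := trace0 u + ∫ t in (0 : ℝ)..y, u.der t

/-- `X¹`, with elements `(φ, θ, z, η)`. -/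
abbrev X1 : Type := H1 × H1 × ℝ × ℝ

/-- `X²`, with elements `(φ, θ, z, η)`. -/
abbrev X2 : Type := H2 × H2 × ℝ × ℝ

/-- The inclusion `X² ⊆ X¹`. -/
def toX1 (m : X2) : X1 := (m.1.toH1, m.2.1.toH1, m.2.2.1, m.2.2.2)

/-! ### The phase space and the Hamiltonian vector field -/

/-- `M₀`: `φ` has zero mean and `θ(0) = θ(1) = 0`. -/
def M0 : Set X1 :=
  {m | ∫ y, m.1.val y ∂vol01 = 0 ∧ trace0 m.2.1 = 0 ∧ trace1 m.2.1 = 0}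

/-- The quantity `z̃ = z + ∫₀¹ y φ_y (θ_y + ω (1 - y) - 1) / (η + 1) dy`. -/
def zt (ω : ℝ) (m : X1) : ℝ :=
  m.2.2.1 + ∫ y, y * m.1.der y * (m.2.1.der y + ω * (1 - y) - 1) / (m.2.2.2 + 1) ∂vol01

/-- The manifold `M^{ω,σ}`. -/
def M (ω σ : ℝ) : Set X1 := {m | m ∈ M0 ∧ |zt ω m| < σ ∧ -1 < m.2.2.2}

/-- `N^{ω,σ} = M^{ω,σ} ∩ X²`. -/
def N (ω σ : ℝ) : Set X2 := {m | toX1 m ∈ M ω σ}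

/-- The component `η_H = z̃ / √(σ² - z̃²)` of the vector field. -/
def etaH (ω σ : ℝ) (m : X1) : ℝ := zt ω m / √(σ ^ 2 - zt ω m ^ 2)

/-- The component `φ_H` of the vector field. -/
def phiH (ω σ : ℝ) (m : X1) (y : ℝ) : ℝ :=
  1 / (m.2.2.2 + 1) *
      (m.2.1.der y + zt ω m * (y * m.1.der y - trace1 m.1) / √(σ ^ 2 - zt ω m ^ 2))
    + ω * (m.2.2.2 + 1) * (y - 1 / 2) - ω / (m.2.2.2 + 1) * (y - 1 / 2)

/-- The component `θ_H` of the vector field. -/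
def thetaH (ω σ : ℝ) (m : X1) (y : ℝ) : ℝ :=
  1 / (m.2.2.2 + 1) *
    (zt ω m * y * (m.2.1.der y + ω * (1 - y) - 1) / √(σ ^ 2 - zt ω m ^ 2) - m.1.der y)

/-- The component `z_H` of the vector field. -/
def zH (ω σ : ℝ) (m : X1) : ℝ :=
  (∫ y, (1 / (2 * (m.2.2.2 + 1) ^ 2) *
      ((m.2.1.der y + ω * (1 - y) - 1) ^ 2 - m.1.der y ^ 2) - 1 / 2) ∂vol01)
    + zt ω m / √(σ ^ 2 - zt ω m ^ 2) *
      (∫ y, y * m.1.der y * (m.2.1.der y + ω * (1 - y) - 1) / (m.2.2.2 + 1) ^ 2 ∂vol01)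
    - ∫ y, ω * y * (m.2.1.der y + ω * (1 - y) - 1) ∂vol01

/-- The domain of the vector field: `φ_y(0) = 0` and
`φ_y(1) - z̃ (θ_y(1) - 1) / √(σ² - z̃²) = 0`. -/
def domVH (ω σ : ℝ) : Set X2 :=
  {m | m ∈ N ω σ ∧ trace0 m.1.derH1 = 0 ∧
    trace1 m.1.derH1 - zt ω (toX1 m) * (trace1 m.2.1.derH1 - 1) /
      √(σ ^ 2 - zt ω (toX1 m) ^ 2) = 0}

/-- `v = v_H(m)`, for `v, m ∈ X¹`; elements of `H¹(0,1)` are equal when they are so a.e. -/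
def IsVH (ω σ : ℝ) (m v : X1) : Prop :=
  v.1.val =ᵐ[vol01] phiH ω σ m ∧ v.2.1.val =ᵐ[vol01] thetaH ω σ m ∧
    v.2.2.1 = zH ω σ m ∧ v.2.2.2 = etaH ω σ m

/-- The open interval `(a,b)` of the real line, with possibly infinite end points. -/
def interval (a b : EReal) : Set ℝ := {x | a < (x : EReal) ∧ (x : EReal) < b}

/-- `γ ∈ C¹((a,b), N^{ω,σ})` lies in the domain of `v_H` and satisfies `γ' = v_H(γ)`. -/
structure IsHamiltonSolution (ω σ : ℝ) (a b : EReal) (γ : ℝ → X2) : Prop where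
  contDiffOn : ContDiffOn ℝ 1 γ (interval a b)
  mem_dom : ∀ x ∈ interval a b, γ x ∈ domVH ω σ
  hamilton : ∀ x ∈ interval a b, IsVH ω σ (toX1 (γ x)) (toX1 (deriv γ x))

/-! ### The velocity potential and the stream function -/

/-- `φ(x, ȳ)` along the curve. -/
def phiCurve (γ : ℝ → X2) (x y : ℝ) : ℝ := rep (γ x).1.toH1 y

/-- `θ(x, ȳ)` along the curve. -/
def thetaCurve (γ : ℝ → X2) (x y : ℝ) : ℝ := rep (γ x).2.1.toH1 y

/-- `η(x)` along the curve. -/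
def etaCurve (γ : ℝ → X2) (x : ℝ) : ℝ := (γ x).2.2.2

/-- The flattened vertical variable `ȳ`, with `y = (η(x) + 1) ȳ - 1`. -/
def ybar (η : ℝ → ℝ) (p : ℝ × ℝ) : ℝ := (p.2 + 1) / (η p.1 + 1)

/-- The velocity potential. -/
def potential (ω x₁ : ℝ) (γ : ℝ → X2) (p : ℝ × ℝ) : ℝ :=
  phiCurve γ p.1 (ybar (etaCurve γ) p) + (2 - ω) / 2 * (p.1 - x₁)
    + ∫ s in x₁..p.1,
        (deriv (etaCurve γ) s / (etaCurve γ s + 1) * phiCurve γ s 1 + ω / 2 * etaCurve γ s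
          + (ω - 2) / (2 * (etaCurve γ s + 1)))

/-- The stream function. -/
def stream (ω : ℝ) (γ : ℝ → X2) (p : ℝ × ℝ) : ℝ :=
  thetaCurve γ p.1 (ybar (etaCurve γ) p) - ω / 2 * (1 - ybar (etaCurve γ) p) ^ 2
    + ybar (etaCurve γ) p * etaCurve γ p.1

/-! ### The free-boundary problem -/

/-- The fluid domain `x₁ < x < x₂`, `-1 < y < η(x)`. -/
def fluid (x₁ x₂ : ℝ) (η : ℝ → ℝ) : Set (ℝ × ℝ) :=
  {p | p.1 ∈ Ioo x₁ x₂ ∧ -1 < p.2 ∧ p.2 < η p.1}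

/-- The fluid domain together with its bottom and its free surface. -/
def fluidBar (x₁ x₂ : ℝ) (η : ℝ → ℝ) : Set (ℝ × ℝ) :=
  {p | p.1 ∈ Ioo x₁ x₂ ∧ -1 ≤ p.2 ∧ p.2 ≤ η p.1}

/-- `∂f/∂x`. -/
def dx (f : ℝ × ℝ → ℝ) (p : ℝ × ℝ) : ℝ := deriv (fun t => f (t, p.2)) p.1

/-- `∂f/∂y`. -/
def dy (f : ℝ × ℝ → ℝ) (p : ℝ × ℝ) : ℝ := deriv (fun t => f (p.1, t)) p.2

/-- `f ∈ Hᵏ(U)`, for an open subset `U` of the plane. -/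
def MemH (U : Set (ℝ × ℝ)) : ℕ → (ℝ × ℝ → ℝ) → Prop
  | 0, f => MemLp f 2 (volume.restrict U)
  | k + 1, f => MemLp f 2 (volume.restrict U) ∧ ∃ g h : ℝ × ℝ → ℝ, MemH U k g ∧ MemH U k h ∧
      ∀ ψ : ℝ × ℝ → ℝ, IsTest U ψ →
        ∫ p in U, f p * dx ψ p = -∫ p in U, g p * ψ p ∧
        ∫ p in U, f p * dy ψ p = -∫ p in U, h p * ψ p

/-- The travelling-wave free-boundary problem over `(x₁,x₂)`: `φ` is a smooth solution of the
Laplace equation in the fluid, `η` is of class `C²`, the partial derivatives of `φ` extend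
continuously to the bottom and the free surface (by `u` and `v`), and these boundary values satisfy
the bottom condition, the kinematic condition and the Bernoulli condition. -/
structure IsTravellingWave (ω σ x₁ x₂ : ℝ) (φ : ℝ × ℝ → ℝ) (η : ℝ → ℝ) : Prop where
  smooth : ContDiffOn ℝ (⊤ : ℕ∞) φ (fluid x₁ x₂ η)
  laplace : ∀ p ∈ fluid x₁ x₂ η, dx (dx φ) p + dy (dy φ) p = 0
  smooth_eta : ContDiffOn ℝ 2 η (Ioo x₁ x₂)
  boundary : ∃ u v : ℝ × ℝ → ℝ,
    ContinuousOn u (fluidBar x₁ x₂ η) ∧ ContinuousOn v (fluidBar x₁ x₂ η) ∧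
    EqOn u (dx φ) (fluid x₁ x₂ η) ∧ EqOn v (dy φ) (fluid x₁ x₂ η) ∧
    ∀ x ∈ Ioo x₁ x₂,
      v (x, -1) = 0 ∧
      -deriv η x = v (x, η x) - (u (x, η x) - ω * η x) * deriv η x ∧
      -u (x, η x) + 1 / 2 * u (x, η x) ^ 2 + 1 / 2 * v (x, η x) ^ 2 - ω * η x * u (x, η x)
        + ω * η x + ω ^ 2 / 2 * η x ^ 2
        - σ * deriv (deriv η) x / (1 + deriv η x ^ 2) ^ (3 / 2 : ℝ) = 0

end CapillaryWave

end

noncomputable section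

open MeasureTheory Set Filter
open scoped Topology RealInnerProductSpace

namespace CapillaryWave

/-! ### Absolutely continuous representatives -/

/-! Point evaluation of the absolutely continuous representative is a functional on `H1` bounded
uniformly in the point (`exists_norm_repL_le`). A `C¹` curve in `X2` therefore gives jointly
continuous `φ`, `θ`, `φ_y`, `θ_y` on the closed strip and jointly continuous `φ_x`, `θ_x`. The
equations for `φ` and `θ`, given only a.e. in `y`, then hold at every `y ∈ [0,1]` (`phi_dot`,
`theta_dot`).

Undoing the flattening by the chain rule, all terms carrying `η_x` cancel. The gradient of the
potential is `(velX, velY)` and that of the stream function is `(-velY, velX - ω y)`. Hence the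
potential and `ζ + ω y²/2` satisfy the Cauchy-Riemann equations and are differentiable, so together
they form a holomorphic function. Interior smoothness and the Laplace equation follow without
elliptic regularity theory. For `H²`, only `φ_xy` and `φ_yy` have to be estimated, and they are
controlled by the `X2` norm along the curve, which is bounded over the compact interval `[x₁, x₂]`;
`φ_xx = -φ_yy` does the rest, and the second derivatives of `ζ` are expressed through those of `φ`.

The bottom and kinematic conditions are the two boundary conditions in the domain of the vector
field. For the Bernoulli condition, `η_x = z̃ / √(σ² - z̃²)` inverts to `z̃ = σ η_x / √(1 + η_x²)`,
so the capillary term is exactly `dz̃/dx`. As `z̃` is `C¹`, this also makes `η` of class `C²`.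
Differentiating `z̃` and inserting the equations of motion differentiated in `y`, the integrals
combine into an exact `y`-derivative (`integral_dot_eq`). Only values at `ȳ = 1` survive
(`hasDerivAt_zt`), and they are the kinetic terms of Bernoulli's law. -/

theorem integral_vol01 (f : ℝ → ℝ) : ∫ y, f y ∂vol01 = ∫ y in (0 : ℝ)..1, f y := by
  rw [intervalIntegral.integral_of_le zero_le_one, integral_Ioc_eq_integral_Ioo]

theorem intervalIntegrable_of_integrable_vol01 {f : ℝ → ℝ} (h : Integrable f vol01) :
    IntervalIntegrable f volume 0 1 := by
  rw [intervalIntegrable_iff_integrableOn_Ioo_of_le zero_le_one]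
  exact h

theorem integrable_L2 (u : L2) : Integrable u vol01 :=
  (Lp.memLp u).integrable (by norm_num)

theorem intervalIntegrable_L2 (u : L2) : IntervalIntegrable u volume 0 1 :=
  intervalIntegrable_of_integrable_vol01 (integrable_L2 u)

theorem integrable_continuousOn_mul {f : ℝ → ℝ} (hf : ContinuousOn f (Icc 0 1)) {g : ℝ → ℝ}
    (hg : Integrable g vol01) : Integrable (fun y => f y * g y) vol01 := by
  have := (intervalIntegrable_of_integrable_vol01 hg).continuousOn_mul
    (by rwa [uIcc_of_le zero_le_one] : ContinuousOn f (uIcc 0 1))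
  rwa [intervalIntegrable_iff_integrableOn_Ioo_of_le zero_le_one] at this

theorem integrable_of_continuousOn {f : ℝ → ℝ} (hf : ContinuousOn f (Icc 0 1)) :
    Integrable f vol01 := by
  simpa using integrable_continuousOn_mul hf (integrable_const (1 : ℝ))

theorem rep_absolutelyContinuous (u : H1) : AbsolutelyContinuousOnInterval (rep u) 0 1 := by
  have h1 : AbsolutelyContinuousOnInterval (fun _ : ℝ => trace0 u) 0 1 :=
    (contDiffOn_const (n := 1)).absolutelyContinuousOnInterval
  exact h1.add ((intervalIntegrable_L2 u.der).absolutelyContinuousOnInterval_intervalIntegral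
    (c := 0) (by simp))

theorem rep_continuousOn (u : H1) : ContinuousOn (rep u) (Icc 0 1) := by
  simpa [uIcc_of_le] using (rep_absolutelyContinuous u).continuousOn

theorem rep_ae_hasDerivAt (u : H1) : ∀ᵐ y ∂vol01, HasDerivAt (rep u) (u.der y) y := by
  rw [ae_restrict_iff' measurableSet_Ioo]
  filter_upwards [(intervalIntegrable_L2 u.der).ae_hasDerivAt_integral] with y hy hy'
  exact (hy (by rw [uIcc_of_le zero_le_one]; exact Ioo_subset_Icc_self hy') 0 (by simp)).const_add _

theorem rep_zero (u : H1) : rep u 0 = trace0 u := by simp [rep]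

theorem rep_one (u : H1) : rep u 1 = trace1 u := by
  have h : ∫ y, (1 - y) * u.der y ∂vol01 = ∫ y, u.der y ∂vol01 - ∫ y, y * u.der y ∂vol01 := by
    rw [← integral_sub (integrable_L2 _)
      (integrable_continuousOn_mul (f := fun y => y) continuousOn_id (integrable_L2 _))]
    simp only [sub_mul, one_mul]
  rw [rep, trace0, trace1, h, ← integral_vol01]
  ring

theorem deriv_ae_eq {f g : ℝ → ℝ} {μ : Measure ℝ} (h : ∀ᵐ y ∂μ, HasDerivAt f (g y) y) :
    deriv f =ᵐ[μ] g := h.mono fun _ hy => hy.deriv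

/-- The fundamental theorem of calculus for absolutely continuous functions. -/
theorem integral_eq_sub_of_ae_hasDerivAt {f g : ℝ → ℝ}
    (hf : AbsolutelyContinuousOnInterval f 0 1) (h : ∀ᵐ y ∂vol01, HasDerivAt f (g y) y) :
    ∫ y, g y ∂vol01 = f 1 - f 0 := by
  rw [← hf.integral_deriv_eq_sub, ← integral_vol01]
  exact integral_congr_ae (deriv_ae_eq h).symm

theorem absolutelyContinuous_of_contDiff {f : ℝ → ℝ} (hf : ContDiff ℝ 1 f) :
    AbsolutelyContinuousOnInterval f 0 1 :=
  hf.contDiffOn.absolutelyContinuousOnInterval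

theorem IsTest.map_zero {ψ : ℝ → ℝ} (h : IsTest (Ioo (0 : ℝ) 1) ψ) {y : ℝ}
    (hy : y ∉ Ioo (0 : ℝ) 1) : ψ y = 0 :=
  image_eq_zero_of_notMem_tsupport fun h' => hy (h.2.2 h')

/-- A test function of zero mean is the derivative of a test function. -/
theorem IsTest.exists_primitive {χ : ℝ → ℝ} (h : IsTest (Ioo (0 : ℝ) 1) χ)
    (h0 : ∫ y, χ y ∂vol01 = 0) : ∃ ψ, IsTest (Ioo (0 : ℝ) 1) ψ ∧ deriv ψ = χ := by
  have hc := h.1.continuous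
  have hd : ∀ y, HasDerivAt (fun y => ∫ t in (0 : ℝ)..y, χ t) (χ y) y := fun y =>
    intervalIntegral.integral_hasDerivAt_right (hc.intervalIntegrable _ _)
      hc.stronglyMeasurable.stronglyMeasurableAtFilter hc.continuousAt
  have hde : deriv (fun y => ∫ t in (0 : ℝ)..y, χ t) = χ := funext fun y => (hd y).deriv
  have hsm : ContDiff ℝ (⊤ : ℕ∞) (fun y => ∫ t in (0 : ℝ)..y, χ t) := by
    rw [show ((⊤ : ℕ∞) : WithTop ℕ∞) = ((⊤ : ℕ∞) : WithTop ℕ∞) + 1 by rfl,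
      contDiff_succ_iff_deriv]
    refine ⟨fun y => (hd y).differentiableAt, by simp, by rw [hde]; exact h.1⟩
  obtain ⟨s, hs1, t, ht1, hst⟩ : ∃ s > (0 : ℝ), ∃ t < (1 : ℝ), tsupport χ ⊆ Icc s t := by
    rcases (tsupport χ).eq_empty_or_nonempty with he | hne
    -- For `χ = 0` any `s > 0` and `t < 1` will do; no order between `s` and `t` is needed.
    · exact ⟨1, one_pos, 0, one_pos, by simp [he]⟩
    · have hK : IsCompact (tsupport χ) := h.2.1
      refine ⟨sInf (tsupport χ), (h.2.2 (hK.sInf_mem hne)).1, sSup (tsupport χ),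
        (h.2.2 (hK.sSup_mem hne)).2, fun y hy => ⟨csInf_le hK.bddBelow hy, le_csSup hK.bddAbove hy⟩⟩
  have hz : ∀ y, y ∉ Icc s t → χ y = 0 := fun y hy =>
    image_eq_zero_of_notMem_tsupport fun h' => hy (hst h')
  have hsupp : Function.support (fun y => ∫ t in (0 : ℝ)..y, χ t) ⊆ Icc s t := by
    intro y hy
    by_contra hn
    apply hy
    simp only [mem_Icc, not_and_or, not_le] at hn
    rcases hn with hn | hn
    · refine intervalIntegral.integral_zero_ae (Eventually.of_forall fun r hr => hz r ?_)
      have : r ≤ max 0 y := hr.2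
      have : max 0 y < s := max_lt hs1 hn
      simp only [mem_Icc, not_and_or, not_le]
      left; linarith
    -- To the right of the support the primitive equals the full integral of `χ`; this is where the
    -- zero mean enters.
    · have h1 : ∫ r in y..1, χ r = 0 := by
        refine intervalIntegral.integral_zero_ae (Eventually.of_forall fun r hr => hz r ?_)
        have h2 : min y 1 < r := hr.1
        have : t < min y 1 := lt_min hn ht1
        simp only [mem_Icc, not_and_or, not_le]
        right; linarith
      have h2 := intervalIntegral.integral_add_adjacent_intervals
        (hc.intervalIntegrable (μ := volume) 0 y) (hc.intervalIntegrable y 1)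
      rw [integral_vol01] at h0
      linarith
  have hts : tsupport (fun y => ∫ t in (0 : ℝ)..y, χ t) ⊆ Icc s t :=
    closure_minimal hsupp isClosed_Icc
  refine ⟨_, ⟨hsm, HasCompactSupport.of_support_subset_isCompact isCompact_Icc hsupp, fun y hy => ?_⟩,
    hde⟩
  exact ⟨hs1.trans_le (hts hy).1, (hts hy).2.trans_lt ht1⟩

theorem exists_isTest_integral_eq_one :
    ∃ χ : ℝ → ℝ, IsTest (Ioo (0 : ℝ) 1) χ ∧ ∫ y, χ y ∂vol01 = 1 := by
  let f : ContDiffBump (1 / 2 : ℝ) := ⟨1 / 8, 1 / 4, by norm_num, by norm_num⟩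
  have hsub : tsupport (f.normed volume) ⊆ Ioo (0 : ℝ) 1 := by
    rw [f.tsupport_normed_eq, Real.closedBall_eq_Icc]
    intro y hy
    simp only [f, mem_Icc, mem_Ioo] at hy ⊢
    constructor <;> linarith [hy.1, hy.2]
  refine ⟨f.normed volume, ⟨f.contDiff_normed, f.hasCompactSupport_normed, hsub⟩, ?_⟩
  rw [setIntegral_eq_integral_of_forall_compl_eq_zero, f.integral_normed]
  intro y hy
  exact image_eq_zero_of_notMem_tsupport fun h' => hy (hsub h')

/-- A function whose weak derivative vanishes is constant. -/
theorem ae_eq_const_of_weakDeriv_zero {w : ℝ → ℝ} (hw : Integrable w vol01)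
    (h : ∀ ψ, IsTest (Ioo (0 : ℝ) 1) ψ → ∫ y, w y * deriv ψ y ∂vol01 = 0) :
    ∃ c : ℝ, w =ᵐ[vol01] fun _ => c := by
  obtain ⟨χ, hχ, hχ1⟩ := exists_isTest_integral_eq_one
  have hint : ∀ {ψ}, IsTest (Ioo (0 : ℝ) 1) ψ → Integrable (fun y => w y * ψ y) vol01 := by
    intro ψ hψ
    simpa only [mul_comm] using integrable_continuousOn_mul hψ.1.continuous.continuousOn hw
  -- du Bois-Reymond: any test function `ψ` is `(∫ ψ) χ` plus one of zero mean. The latter is a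
  -- derivative, hence annihilated by `w`, which leaves `∫ w ψ = (∫ w χ) (∫ ψ)`.
  refine ⟨∫ y, w y * χ y ∂vol01, ?_⟩
  set c := ∫ y, w y * χ y ∂vol01
  have hloc : LocallyIntegrableOn (fun y => w y - c) (Ioo (0 : ℝ) 1) volume :=
    IntegrableOn.locallyIntegrableOn (hw.sub (integrable_const c))
  have := isOpen_Ioo.ae_eq_zero_of_integral_contDiff_smul_eq_zero hloc (fun ψ h1 h2 h3 => by
    have hψ : IsTest (Ioo (0 : ℝ) 1) ψ := ⟨h1, h2, h3⟩
    set d := ∫ y, ψ y ∂vol01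
    have hψi : Integrable ψ vol01 := integrable_of_continuousOn hψ.1.continuous.continuousOn
    have hχi : Integrable χ vol01 := integrable_of_continuousOn hχ.1.continuous.continuousOn
    have hρ : IsTest (Ioo (0 : ℝ) 1) (fun y => ψ y - d * χ y) := by
      have hsupp : tsupport (fun y => ψ y - d * χ y) ⊆ tsupport ψ ∪ tsupport χ := by
        refine closure_minimal (fun y hy => ?_) ((isClosed_tsupport _).union (isClosed_tsupport _))
        by_contra hn
        simp only [mem_union, not_or] at hn
        exact hy (by
          simp [image_eq_zero_of_notMem_tsupport hn.1, image_eq_zero_of_notMem_tsupport hn.2])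
      exact ⟨hψ.1.sub (contDiff_const.mul hχ.1),
        (hψ.2.1.isCompact.union hχ.2.1.isCompact).of_isClosed_subset (isClosed_tsupport _) hsupp,
        hsupp.trans (union_subset hψ.2.2 hχ.2.2)⟩
    obtain ⟨Ψ, hΨ, hΨd⟩ := hρ.exists_primitive (by
      rw [integral_sub hψi (hχi.const_mul d), integral_const_mul, hχ1]; simp [d])
    have h0 := h Ψ hΨ
    rw [hΨd] at h0
    have h4 : ∫ y, w y * (ψ y - d * χ y) ∂vol01 = ∫ y, w y * ψ y ∂vol01 - d * c := by
      rw [← integral_const_mul, ← integral_sub (hint hψ) ((hint hχ).const_mul d)]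
      congr 1; ext y; ring
    have h5 : ∫ y, ψ y • (w y - c) = ∫ y, ψ y • (w y - c) ∂vol01 := by
      symm
      refine setIntegral_eq_integral_of_forall_compl_eq_zero fun y hy => ?_
      rw [hψ.map_zero hy, zero_smul]
    have h6 : ∫ y, ψ y • (w y - c) ∂vol01 = ∫ y, w y * ψ y ∂vol01 - c * d := by
      rw [← integral_const_mul, ← integral_sub (hint hψ) (hψi.const_mul c)]
      congr 1; ext y; simp only [smul_eq_mul]; ring
    rw [h5, h6]; linarith)
  rw [Filter.EventuallyEq, ae_restrict_iff' measurableSet_Ioo]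
  filter_upwards [this] with y hy hy'
  linarith [hy hy']

theorem integral_rep_mul_deriv (u : H1) {ψ : ℝ → ℝ} (hψ : IsTest (Ioo (0 : ℝ) 1) ψ) :
    ∫ y, rep u y * deriv ψ y ∂vol01 = -∫ y, u.der y * ψ y ∂vol01 := by
  have hψ1 : ContDiff ℝ 1 ψ := hψ.1.of_le (by exact_mod_cast le_top)
  have := (rep_absolutelyContinuous u).integral_mul_deriv_eq_deriv_mul
    (absolutelyContinuous_of_contDiff hψ1)
  rw [← integral_vol01, ← integral_vol01, hψ.map_zero (by simp), hψ.map_zero (by simp)] at this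
  rw [this]
  simp only [mul_zero, sub_self, zero_sub, neg_inj]
  refine integral_congr_ae ((deriv_ae_eq (rep_ae_hasDerivAt u)).mono fun y hy => ?_)
  simp only [hy]

/-- Integrate the derivative of `(y - 1) * rep u y`; the weight vanishes at `1`, so only the value
at `0` appears. -/
theorem integral_rep (u : H1) :
    ∫ y, rep u y ∂vol01 = trace0 u + ∫ y, (1 - y) * u.der y ∂vol01 := by
  have hac := (rep_absolutelyContinuous u).fun_mul
    (absolutelyContinuous_of_contDiff (f := fun y => y - 1) (by fun_prop))
  have h := integral_eq_sub_of_ae_hasDerivAt hac ((rep_ae_hasDerivAt u).mono fun y hy =>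
    hy.mul ((hasDerivAt_id y).sub_const 1))
  simp only [mul_one] at h
  rw [integral_add ?_ (integrable_of_continuousOn (rep_continuousOn u))] at h
  · have h2 : ∫ y, (1 - y) * u.der y ∂vol01 = -∫ y, u.der y * (y - 1) ∂vol01 := by
      rw [← integral_neg]; congr 1; ext y; ring
    rw [h2, ← rep_zero]; linarith
  · simpa only [mul_comm] using integrable_continuousOn_mul
      (f := fun y => y - 1) (by fun_prop) (integrable_L2 u.der)

/-- Both sides have the weak derivative `u.der`, so they differ by a constant. The constant is zero
because `trace0` is defined so as to give both the same mean. -/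
theorem rep_ae_eq (u : H1) : rep u =ᵐ[vol01] u.val := by
  have hri := integrable_of_continuousOn (rep_continuousOn u)
  obtain ⟨c, hc⟩ := ae_eq_const_of_weakDeriv_zero (hri.sub (integrable_L2 u.val)) (by
    intro ψ hψ
    have h1 := hψ.integrable_mul_deriv u.val
    have hψ1 : Continuous (deriv ψ) := hψ.1.continuous_deriv (by simp)
    have h2 : Integrable (fun y => rep u y * deriv ψ y) vol01 :=
      integrable_of_continuousOn ((rep_continuousOn u).mul hψ1.continuousOn)
    have h3 : ∫ y, (rep u - u.val) y * deriv ψ y ∂vol01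
        = ∫ y, rep u y * deriv ψ y ∂vol01 - ∫ y, u.val y * deriv ψ y ∂vol01 := by
      rw [← integral_sub h2 h1]
      congr 1; ext y; simp only [Pi.sub_apply]; ring
    have h4 : ∫ y, u.val y * deriv ψ y ∂vol01 = -∫ y, u.der y * ψ y ∂vol01 := u.2 ψ hψ
    rw [h3, h4, integral_rep_mul_deriv u hψ, sub_self])
  have h5 : ∫ y, (rep u - u.val) y ∂vol01 = 0 := by
    simp only [Pi.sub_apply]
    rw [integral_sub hri (integrable_L2 _), integral_rep, trace0]; ring
  rw [integral_congr_ae hc] at h5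
  simp at h5
  filter_upwards [hc] with y hy
  simp only [Pi.sub_apply, h5] at hy
  linarith

/-- Turns the a.e. form of Hamilton's equations into a pointwise one that includes the end points.
-/
theorem eqOn_Icc_of_ae_eq {f g : ℝ → ℝ} (hf : ContinuousOn f (Icc 0 1))
    (hg : ContinuousOn g (Icc 0 1)) (h : f =ᵐ[vol01] g) : EqOn f g (Icc 0 1) := by
  have h' : f =ᵐ[volume.restrict (Icc (0 : ℝ) 1)] g := by
    rwa [← Measure.restrict_congr_set (Ioo_ae_eq_Icc (μ := volume) (a := (0 : ℝ)) (b := 1))]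
  exact Measure.eqOn_Icc_of_ae_eq volume zero_ne_one h' hf hg

theorem rep_toH1_eq_integral (u : H2) {y : ℝ} (hy : y ∈ Icc (0 : ℝ) 1) :
    rep u.toH1 y = trace0 u.toH1 + ∫ t in (0 : ℝ)..y, rep u.derH1 t := by
  rw [rep]
  congr 1
  refine intervalIntegral.integral_congr_ae ?_
  have h := rep_ae_eq u.derH1
  rw [Filter.EventuallyEq, ae_restrict_iff' measurableSet_Ioo] at h
  filter_upwards [h, (by simp [ae_iff, measure_singleton] : ∀ᵐ t : ℝ, t ≠ 1)] with t ht ht1 ht'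
  rw [uIoc_of_le hy.1] at ht'
  exact (ht ⟨ht'.1, lt_of_le_of_ne (ht'.2.trans hy.2) ht1⟩).symm

/-- For `u ∈ H²` the integrand in `rep` may be replaced by its continuous representative, so the
fundamental theorem of calculus applies at every interior point, not only a.e. -/
theorem rep_hasDerivAt (u : H2) {y : ℝ} (hy : y ∈ Ioo (0 : ℝ) 1) :
    HasDerivAt (rep u.toH1) (rep u.derH1 y) y := by
  have hc := rep_continuousOn u.derH1
  have hn : Icc (0 : ℝ) 1 ∈ 𝓝 y := Icc_mem_nhds hy.1 hy.2
  have h1 : HasDerivAt (fun y => trace0 u.toH1 + ∫ t in (0 : ℝ)..y, rep u.derH1 t)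
      (rep u.derH1 y) y := by
    refine HasDerivAt.const_add _ ?_
    refine intervalIntegral.integral_hasDerivAt_right ?_ ?_ (hc.continuousAt hn)
    · refine (hc.mono ?_).intervalIntegrable
      rw [uIcc_of_le hy.1.le]
      exact Icc_subset_Icc_right hy.2.le
    · exact (hc.mono Ioo_subset_Icc_self).stronglyMeasurableAtFilter isOpen_Ioo y hy
  refine h1.congr_of_eventuallyEq ?_
  filter_upwards [hn] with t ht
  exact rep_toH1_eq_integral u ht

/-! ### Continuous linear maps between the function spaces -/

/-- `H1.val` as a continuous linear map. -/
def valL : H1 →L[ℝ] L2 := (ContinuousLinearMap.fst ℝ L2 L2).comp H1Submodule.subtypeL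

/-- `H1.der` as a continuous linear map. -/
def derL : H1 →L[ℝ] L2 := (ContinuousLinearMap.snd ℝ L2 L2).comp H1Submodule.subtypeL

@[simp] theorem valL_apply (u : H1) : valL u = u.val := rfl

@[simp] theorem derL_apply (u : H1) : derL u = u.der := rfl

/-- `H2.toH1` as a continuous linear map. -/
def toH1L : H2 →L[ℝ] H1 :=
  (((ContinuousLinearMap.fst ℝ L2 (L2 × L2)).prod
    ((ContinuousLinearMap.fst ℝ L2 L2).comp (ContinuousLinearMap.snd ℝ L2 (L2 × L2)))).comp
      H2Submodule.subtypeL).codRestrict H1Submodule fun u => u.2.1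

/-- `H2.derH1` as a continuous linear map. -/
def derH1L : H2 →L[ℝ] H1 :=
  ((ContinuousLinearMap.snd ℝ L2 (L2 × L2)).comp
      H2Submodule.subtypeL).codRestrict H1Submodule fun u => u.2.2

@[simp] theorem toH1L_apply (u : H2) : toH1L u = u.toH1 := rfl

@[simp] theorem derH1L_apply (u : H2) : derH1L u = u.derH1 := rfl

theorem memLp_of_continuous {f : ℝ → ℝ} (hf : Continuous f) (p : ENNReal) : MemLp f p vol01 := by
  obtain ⟨C, hC⟩ := (isCompact_Icc (a := (0 : ℝ)) (b := 1)).exists_bound_of_continuousOn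
    hf.continuousOn
  refine MemLp.of_bound hf.aestronglyMeasurable C ?_
  rw [ae_restrict_iff' measurableSet_Ioo]
  exact Eventually.of_forall fun y hy => hC y (Ioo_subset_Icc_self hy)

/-- A continuous function as an element of `L²(0,1)`. -/
def contL2 (f : ℝ → ℝ) (hf : Continuous f) : L2 := (memLp_of_continuous hf 2).toLp f

theorem contL2_ae_eq (f : ℝ → ℝ) (hf : Continuous f) : contL2 f hf =ᵐ[vol01] f :=
  MemLp.coeFn_toLp _

theorem inner_eq_integral (u v : L2) : ⟪u, v⟫ = ∫ y, u y * v y ∂vol01 := by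
  rw [L2.inner_def]
  congr 1; ext y
  simp [mul_comm]

theorem inner_contL2 (f : ℝ → ℝ) (hf : Continuous f) (u : L2) :
    ⟪contL2 f hf, u⟫ = ∫ y, f y * u y ∂vol01 := by
  rw [inner_eq_integral]
  refine integral_congr_ae ((contL2_ae_eq f hf).mono fun y hy => ?_)
  simp only [hy]

/-- The indicator function of `(0,y)` in `L²(0,1)`. -/
def indL2 (y : ℝ) : L2 :=
  indicatorConstLp 2 (measurableSet_Ioo (a := (0 : ℝ)) (b := y)) (measure_ne_top vol01 _) (1 : ℝ)

theorem norm_indL2_le (y : ℝ) : ‖indL2 y‖ ≤ 1 := by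
  refine (norm_indicatorConstLp_le).trans ?_
  rw [norm_one, one_mul]
  refine Real.rpow_le_one measureReal_nonneg ?_ (by positivity)
  refine (measureReal_mono (subset_univ _)).trans ?_
  simp [Measure.real]

theorem inner_indL2 {y : ℝ} (hy : y ∈ Icc (0 : ℝ) 1) (u : L2) :
    ⟪indL2 y, u⟫ = ∫ t in (0 : ℝ)..y, u t := by
  rw [indL2, L2.inner_indicatorConstLp_one, intervalIntegral.integral_of_le hy.1,
    integral_Ioc_eq_integral_Ioo, Measure.restrict_restrict measurableSet_Ioo,
    inter_eq_left.2 (Ioo_subset_Ioo_right hy.2)]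

/-- Evaluation of the absolutely continuous representative at a point of `[0,1]`. -/
def repL (y : ℝ) : H1 →L[ℝ] ℝ :=
  (innerSL ℝ (contL2 (fun _ => 1) continuous_const)).comp valL
    - (innerSL ℝ (contL2 (fun y => 1 - y) (by fun_prop))).comp derL
    + (innerSL ℝ (indL2 y)).comp derL

theorem repL_apply {y : ℝ} (hy : y ∈ Icc (0 : ℝ) 1) (u : H1) : repL y u = rep u y := by
  simp only [repL, add_apply, sub_apply,
    ContinuousLinearMap.comp_apply, innerSL_apply_apply, valL_apply, derL_apply, inner_contL2,
    inner_indL2 hy, rep, trace0, one_mul]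
  ring

/-- The embedding of `H¹` in the bounded functions: only the last summand of `repL y` depends on
`y`, and the indicator in it has norm at most `1`. -/
theorem exists_norm_repL_le : ∃ C, ∀ y, ‖repL y‖ ≤ C := by
  refine ⟨‖(innerSL ℝ (contL2 (fun _ => 1) continuous_const)).comp valL
    - (innerSL ℝ (contL2 (fun y => 1 - y) (by fun_prop))).comp derL‖ + 1 * ‖derL‖, fun y => ?_⟩
  refine (norm_add_le (E := H1 →L[ℝ] ℝ) _ _).trans (add_le_add le_rfl ?_)
  refine (ContinuousLinearMap.opNorm_comp_le _ _).trans
    (mul_le_mul_of_nonneg_right ?_ (norm_nonneg _))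
  rw [innerSL_apply_norm]
  exact norm_indL2_le y

/-- Continuity in `x` is uniform in `y`, because the evaluation functionals are uniformly bounded;
continuity in `y` is then needed only for one fixed `x`. -/
theorem rep_continuousOn_prod {I : Set ℝ} {w : ℝ → H1} (hw : ContinuousOn w I) :
    ContinuousOn (fun p : ℝ × ℝ => rep (w p.1) p.2) (I ×ˢ Icc (0 : ℝ) 1) := by
  obtain ⟨C, hC⟩ := exists_norm_repL_le
  rintro ⟨x, y⟩ ⟨hx, hy⟩
  have h1 : ContinuousWithinAt (fun p : ℝ × ℝ => rep (w x) p.2) (I ×ˢ Icc (0 : ℝ) 1) (x, y) :=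
    (rep_continuousOn (w x)).comp (s := I ×ˢ Icc (0 : ℝ) 1) continuousOn_snd
      (fun p hp => hp.2) (x, y) ⟨hx, hy⟩
  have h2 : Tendsto (fun p : ℝ × ℝ => C * ‖w p.1 - w x‖) (𝓝[I ×ˢ Icc (0 : ℝ) 1] (x, y)) (𝓝 0) := by
    have h3 : ContinuousWithinAt (fun p : ℝ × ℝ => w p.1) (I ×ˢ Icc (0 : ℝ) 1) (x, y) :=
      (hw x hx).comp (t := I) continuousWithinAt_fst (fun p hp => hp.1)
    have h4 := ((h3.sub continuousWithinAt_const).norm (f := fun p : ℝ × ℝ => w p.1 - w x)).const_mul C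
    simpa [ContinuousWithinAt] using h4
  have h5 : Tendsto (fun p : ℝ × ℝ => rep (w p.1) p.2 - rep (w x) p.2)
      (𝓝[I ×ˢ Icc (0 : ℝ) 1] (x, y)) (𝓝 0) := by
    refine squeeze_zero_norm' ?_ h2
    filter_upwards [self_mem_nhdsWithin] with p hp
    rw [← repL_apply hp.2, ← repL_apply hp.2, ← map_sub]
    exact (repL p.2).le_of_opNorm_le (hC _) _
  have h6 := h5.add h1
  simp only [sub_add_cancel, zero_add] at h6
  exact h6

theorem hasDerivAt_rep {w : ℝ → H1} {w' : H1} {x y : ℝ} (hy : y ∈ Icc (0 : ℝ) 1)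
    (hw : HasDerivAt w w' x) : HasDerivAt (fun x => rep (w x) y) (rep w' y) x := by
  have := (repL y).hasFDerivAt.comp_hasDerivAt x hw
  simpa only [Function.comp_def, repL_apply hy] using this

/-- The `x`-derivative commutes with the continuous linear evaluation, and the `y`-derivative is
classical for `H²`. Both are jointly continuous, hence the function is Fréchet differentiable. -/
theorem hasFDerivAt_rep {I : Set ℝ} (hI : IsOpen I) {w w' : ℝ → H2} {x y : ℝ} (hx : x ∈ I)
    (hy : y ∈ Ioo (0 : ℝ) 1) (hw : ∀ x ∈ I, HasDerivAt w (w' x) x) (hw' : ContinuousOn w' I) :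
    HasFDerivAt (fun p : ℝ × ℝ => rep (w p.1).toH1 p.2)
      ((ContinuousLinearMap.toSpanSingleton ℝ (rep (w' x).toH1 y)).coprod
        (ContinuousLinearMap.toSpanSingleton ℝ (rep (w x).derH1 y))) (x, y) := by
  have hn : I ×ˢ Ioo (0 : ℝ) 1 ∈ 𝓝 (x, y) := (hI.prod isOpen_Ioo).mem_nhds ⟨hx, hy⟩
  have hn' : I ×ˢ Icc (0 : ℝ) 1 ∈ 𝓝 (x, y) :=
    mem_of_superset hn (prod_mono_right Ioo_subset_Icc_self)
  have hwc : ContinuousOn w I := fun x hx => (hw x hx).continuousAt.continuousWithinAt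
  have c1 := (rep_continuousOn_prod (toH1L.continuous.comp_continuousOn hw')).continuousAt hn'
  have c2 := (rep_continuousOn_prod (derH1L.continuous.comp_continuousOn hwc)).continuousAt hn'
  have hts : Continuous (fun a : ℝ => ContinuousLinearMap.toSpanSingleton ℝ a) :=
    (ContinuousLinearMap.toSpanSingletonCLE (𝕜 := ℝ) (E := ℝ)).continuous
  have := hasStrictFDerivAt_uncurry_coprod (𝕜 := ℝ) (u := (x, y))
    (f := fun x y => rep (w x).toH1 y)
    (f₁ := fun x y => ContinuousLinearMap.toSpanSingleton ℝ (rep (w' x).toH1 y))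
    (f₂ := fun x y => ContinuousLinearMap.toSpanSingleton ℝ (rep (w x).derH1 y))
    (by
      filter_upwards [hn'] with p hp
      exact (hasDerivAt_rep hp.2 (toH1L.hasFDerivAt.comp_hasDerivAt p.1 (hw p.1 hp.1))).hasFDerivAt)
    (by
      filter_upwards [hn] with p hp
      exact (rep_hasDerivAt (w p.1) hp.2).hasFDerivAt)
    (hts.continuousAt.comp c1) (hts.continuousAt.comp c2)
  exact this.hasFDerivAt

/-- Multiplication by `y` in `L²(0,1)`. -/
def mulYL : L2 →L[ℝ] L2 :=
  (ContinuousLinearMap.mul ℝ ℝ).holderL vol01 ⊤ 2 2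
    ((memLp_of_continuous continuous_id ⊤).toLp id)

theorem mulYL_ae_eq (u : L2) : mulYL u =ᵐ[vol01] fun y => y * u y := by
  have h := (ContinuousLinearMap.mul ℝ ℝ).coeFn_holder (r := 2)
    ((memLp_of_continuous continuous_id ⊤).toLp id : Lp ℝ ⊤ vol01) u
  filter_upwards [h, (memLp_of_continuous continuous_id ⊤).coeFn_toLp] with y h1 h2
  rw [h2] at h1
  exact h1

theorem inner_mulYL (u v : L2) : ⟪mulYL u, v⟫ = ∫ y, y * u y * v y ∂vol01 := by
  rw [inner_eq_integral]
  refine integral_congr_ae ((mulYL_ae_eq u).mono fun y hy => ?_)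
  simp only [hy]

/-! ### Calculus along a solution of Hamilton's equations -/

theorem isOpen_interval (a b : EReal) : IsOpen (interval a b) :=
  (isOpen_Ioi.preimage continuous_coe_real_ereal).inter
    (isOpen_Iio.preimage continuous_coe_real_ereal)

theorem Icc_subset_interval {a b : EReal} {x₁ x₂ : ℝ} (h₁ : a < x₁) (h₂ : x₂ < b) :
    Icc x₁ x₂ ⊆ interval a b := fun _ hx =>
  ⟨h₁.trans_le (EReal.coe_le_coe_iff.2 hx.1), (EReal.coe_le_coe_iff.2 hx.2).trans_lt h₂⟩

/-- The function `ω (1 - y) - 1` in `L²(0,1)`. -/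
def shearL2 (ω : ℝ) : L2 := contL2 (fun y => ω * (1 - y) - 1) (by fun_prop)

theorem inner_mulYL_add_shearL2 (ω : ℝ) (u v : L2) :
    ⟪mulYL u, v + shearL2 ω⟫ = ∫ y, y * u y * (v y + ω * (1 - y) - 1) ∂vol01 := by
  rw [inner_mulYL]
  refine integral_congr_ae ?_
  filter_upwards [Lp.coeFn_add v (shearL2 ω), contL2_ae_eq (fun y => ω * (1 - y) - 1) (by fun_prop)]
    with y h1 h2
  rw [h1, Pi.add_apply, shearL2, h2]
  ring

/-- As an inner product of curves in `L²`, the integral can be differentiated in `x` by the product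
rule, with no differentiation under the integral sign. -/
theorem zt_eq_inner (ω : ℝ) (m : X2) :
    zt ω (toX1 m) = m.2.2.1
      + ⟪mulYL m.1.derH1.val, m.2.1.derH1.val + shearL2 ω⟫ / (m.2.2.2 + 1) := by
  rw [inner_mulYL_add_shearL2, ← integral_div]
  rfl

/-- The integral identity behind the Bernoulli condition. -/
theorem integral_dot_eq {ω H r : ℝ} (hH : H ≠ 0) {P Q p q P' Q' : ℝ → ℝ}
    (hP : AbsolutelyContinuousOnInterval P 0 1) (hQ : AbsolutelyContinuousOnInterval Q 0 1)
    (hp : ∀ᵐ y ∂vol01, HasDerivAt P (p y) y) (hq : ∀ᵐ y ∂vol01, HasDerivAt Q (q y) y)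
    (hP' : ∀ᵐ y ∂vol01, P' y = 1 / H * (q y + r * (P y + y * p y)) + ω * H)
    (hQ' : ∀ᵐ y ∂vol01, Q' y = 1 / H * (r * (Q y + y * q y) - p y)) :
    ∫ y, (y * P' y * Q y + y * P y * Q' y) ∂vol01
      = 1 / H * ((Q 1 ^ 2 - P 1 ^ 2) / 2 + r * (P 1 * Q 1) - ∫ y, (Q y ^ 2 - P y ^ 2) / 2 ∂vol01)
        + ω * H * ∫ y, y * Q y ∂vol01 := by
  have hPc : ContinuousOn P (Icc 0 1) := by simpa [uIcc_of_le] using hP.continuousOn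
  have hQc : ContinuousOn Q (Icc 0 1) := by simpa [uIcc_of_le] using hQ.continuousOn
  have hid : AbsolutelyContinuousOnInterval (fun y : ℝ => y) 0 1 :=
    absolutelyContinuous_of_contDiff contDiff_id
  -- The primitive `y (½ (Q² - P²) + r y P Q)`: once `P'` and `Q'` are inserted, its derivative is
  -- `H` times the integrand sought plus terms without `y`-derivatives. It vanishes at `0` and gives
  -- the boundary term at `1`.
  have hG : AbsolutelyContinuousOnInterval
      (fun y => y * (1 / 2 * (Q y * Q y - P y * P y) + r * (y * (P y * Q y)))) 0 1 :=
    hid.fun_mul ((((hQ.fun_mul hQ).fun_sub (hP.fun_mul hP)).const_mul (1 / 2)).fun_add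
      ((hid.fun_mul (hP.fun_mul hQ)).const_mul r))
  have hi1 : Integrable (fun y => (Q y ^ 2 - P y ^ 2) / 2) vol01 :=
    integrable_of_continuousOn (by fun_prop)
  have hi2 : Integrable (fun y => y * Q y) vol01 := integrable_of_continuousOn (by fun_prop)
  have hGd : ∀ᵐ y ∂vol01, HasDerivAt
      (fun y => y * (1 / 2 * (Q y * Q y - P y * P y) + r * (y * (P y * Q y))))
      (H * (y * P' y * Q y + y * P y * Q' y) + (Q y ^ 2 - P y ^ 2) / 2
        - ω * H ^ 2 * (y * Q y)) y := by
    filter_upwards [hp, hq, hP', hQ'] with y h1 h2 h3 h4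
    have hd := (hasDerivAt_id y).fun_mul ((((h2.fun_mul h2).fun_sub (h1.fun_mul h1)).const_mul
      (1 / 2)).fun_add (((hasDerivAt_id y).fun_mul (h1.fun_mul h2)).const_mul r))
    refine hd.congr_deriv ?_
    rw [h3, h4]
    simp only [id]
    field_simp
    ring
  have hF := integral_eq_sub_of_ae_hasDerivAt hG hGd
  -- Integrability of this sum is recovered from the derivative of the absolutely continuous
  -- primitive.
  have hi3 : Integrable (fun y => y * P' y * Q y + y * P y * Q' y) vol01 := by
    have h1 : Integrable (deriv
        (fun y => y * (1 / 2 * (Q y * Q y - P y * P y) + r * (y * (P y * Q y))))) vol01 := by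
      have := hG.intervalIntegrable_deriv
      rwa [intervalIntegrable_iff_integrableOn_Ioo_of_le zero_le_one] at this
    have h2 := ((h1.sub hi1).add (hi2.const_mul (ω * H ^ 2))).const_mul (1 / H)
    refine h2.congr ?_
    filter_upwards [deriv_ae_eq hGd] with y hy
    simp only [Pi.add_apply, Pi.sub_apply, hy]
    field_simp
    ring
  have hi4 : Integrable (fun y => H * (y * P' y * Q y + y * P y * Q' y)
      + (Q y ^ 2 - P y ^ 2) / 2) vol01 := (hi3.const_mul H).add hi1
  rw [integral_sub hi4 (hi2.const_mul _),
    integral_add (hi3.const_mul H) hi1, integral_const_mul, integral_const_mul] at hF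
  generalize ∫ y, (y * P' y * Q y + y * P y * Q' y) ∂vol01 = A at hF ⊢
  field_simp
  linear_combination 2 * hF

/-! ### Pointwise equations of motion, the derivative of `z̃`, and the curvature of the surface. -/

namespace IsHamiltonSolution

variable {ω σ : ℝ} {a b : EReal} {γ : ℝ → X2}

theorem hasDerivAt (hγ : IsHamiltonSolution ω σ a b γ) {x : ℝ} (hx : x ∈ interval a b) :
    HasDerivAt γ (deriv γ x) x :=
  ((hγ.contDiffOn.contDiffAt ((isOpen_interval a b).mem_nhds hx)).differentiableAt
    one_ne_zero).hasDerivAt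

theorem continuousOn (hγ : IsHamiltonSolution ω σ a b γ) : ContinuousOn γ (interval a b) :=
  hγ.contDiffOn.continuousOn

theorem continuousOn_deriv (hγ : IsHamiltonSolution ω σ a b γ) :
    ContinuousOn (deriv γ) (interval a b) :=
  hγ.contDiffOn.continuousOn_deriv_of_isOpen (isOpen_interval a b) le_rfl

theorem eta_pos (hγ : IsHamiltonSolution ω σ a b γ) {x : ℝ} (hx : x ∈ interval a b) :
    0 < etaCurve γ x + 1 := by
  have : -1 < etaCurve γ x := (hγ.mem_dom x hx).1.2.2
  linarith

theorem hasDerivAt_eta (hγ : IsHamiltonSolution ω σ a b γ) {x : ℝ} (hx : x ∈ interval a b) :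
    HasDerivAt (etaCurve γ) (etaH ω σ (toX1 (γ x))) x := by
  rw [← (hγ.hamilton x hx).2.2.2]
  exact (hγ.hasDerivAt hx).snd.snd.snd

theorem sigma_sq_sub_pos (hγ : IsHamiltonSolution ω σ a b γ) {x : ℝ} (hx : x ∈ interval a b) :
    0 < σ ^ 2 - zt ω (toX1 (γ x)) ^ 2 := by
  have h : |zt ω (toX1 (γ x))| < σ := (hγ.mem_dom x hx).1.2.1
  have := sq_lt_sq' (abs_lt.1 h).1 (abs_lt.1 h).2
  linarith

theorem phi_dot (hγ : IsHamiltonSolution ω σ a b γ) {x y : ℝ} (hx : x ∈ interval a b)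
    (hy : y ∈ Icc (0 : ℝ) 1) :
    rep (deriv γ x).1.toH1 y = 1 / (etaCurve γ x + 1) *
      (rep (γ x).2.1.derH1 y
        + deriv (etaCurve γ) x * (y * rep (γ x).1.derH1 y - phiCurve γ x 1))
      + ω * (etaCurve γ x + 1) * (y - 1 / 2) - ω / (etaCurve γ x + 1) * (y - 1 / 2) := by
  refine eqOn_Icc_of_ae_eq (rep_continuousOn _)
    (g := fun y => 1 / (etaCurve γ x + 1) * (rep (γ x).2.1.derH1 y
        + deriv (etaCurve γ) x * (y * rep (γ x).1.derH1 y - phiCurve γ x 1))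
      + ω * (etaCurve γ x + 1) * (y - 1 / 2) - ω / (etaCurve γ x + 1) * (y - 1 / 2)) ?_ ?_ hy
  · have h1 := rep_continuousOn (γ x).2.1.derH1
    have h2 := rep_continuousOn (γ x).1.derH1
    fun_prop
  · filter_upwards [rep_ae_eq (deriv γ x).1.toH1, (hγ.hamilton x hx).1,
      rep_ae_eq (γ x).2.1.derH1, rep_ae_eq (γ x).1.derH1] with y h1 h2 h3 h4
    rw [h1, (hγ.hasDerivAt_eta hx).deriv, h3, h4, phiCurve, rep_one]
    refine h2.trans ?_
    simp only [phiH, etaH]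
    change 1 / (etaCurve γ x + 1) * ((γ x).2.1.derH1.val y + zt ω (toX1 (γ x)) *
      (y * (γ x).1.derH1.val y - trace1 (γ x).1.toH1) / √(σ ^ 2 - zt ω (toX1 (γ x)) ^ 2))
      + ω * (etaCurve γ x + 1) * (y - 1 / 2) - ω / (etaCurve γ x + 1) * (y - 1 / 2) = _
    ring

theorem theta_dot (hγ : IsHamiltonSolution ω σ a b γ) {x y : ℝ} (hx : x ∈ interval a b)
    (hy : y ∈ Icc (0 : ℝ) 1) :
    rep (deriv γ x).2.1.toH1 y = 1 / (etaCurve γ x + 1) *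
      (deriv (etaCurve γ) x * (y * (rep (γ x).2.1.derH1 y + ω * (1 - y) - 1))
        - rep (γ x).1.derH1 y) := by
  refine eqOn_Icc_of_ae_eq (rep_continuousOn _)
    (g := fun y => 1 / (etaCurve γ x + 1) *
      (deriv (etaCurve γ) x * (y * (rep (γ x).2.1.derH1 y + ω * (1 - y) - 1))
        - rep (γ x).1.derH1 y)) ?_ ?_ hy
  · have h1 := rep_continuousOn (γ x).2.1.derH1
    have h2 := rep_continuousOn (γ x).1.derH1
    fun_prop
  · filter_upwards [rep_ae_eq (deriv γ x).2.1.toH1, (hγ.hamilton x hx).2.1,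
      rep_ae_eq (γ x).2.1.derH1, rep_ae_eq (γ x).1.derH1] with y h1 h2 h3 h4
    rw [h1, (hγ.hasDerivAt_eta hx).deriv, h3, h4]
    refine h2.trans ?_
    simp only [thetaH, etaH]
    change 1 / (etaCurve γ x + 1) * (zt ω (toX1 (γ x)) * y *
      ((γ x).2.1.derH1.val y + ω * (1 - y) - 1) / √(σ ^ 2 - zt ω (toX1 (γ x)) ^ 2)
        - (γ x).1.derH1.val y) = _
    ring

/-- Differentiates `phi_dot` in `y`. The left side is differentiable because `deriv γ x` takes
values in `X2`; the right side is so only a.e., as `θ_yy` and `φ_yy` are merely in `L²`. -/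
theorem phi_dot_deriv (hγ : IsHamiltonSolution ω σ a b γ) {x : ℝ} (hx : x ∈ interval a b) :
    ∀ᵐ y ∂vol01, rep (deriv γ x).1.derH1 y = 1 / (etaCurve γ x + 1) *
      ((γ x).2.1.derH1.der y - ω
        + deriv (etaCurve γ) x * (rep (γ x).1.derH1 y + y * (γ x).1.derH1.der y))
      + ω * (etaCurve γ x + 1) := by
  filter_upwards [rep_ae_hasDerivAt (γ x).2.1.derH1, rep_ae_hasDerivAt (γ x).1.derH1,
    ae_restrict_mem measurableSet_Ioo] with y h1 h2 hy
  have h3 := rep_hasDerivAt (deriv γ x).1 hy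
  have hn : Icc (0 : ℝ) 1 ∈ 𝓝 y := Icc_mem_nhds hy.1 hy.2
  have hy1 := (hasDerivAt_id y).sub_const (1 / 2)
  have h4 := (((h1.fun_add ((((hasDerivAt_id y).fun_mul h2).sub_const
    (phiCurve γ x 1)).const_mul (deriv (etaCurve γ) x))).const_mul (1 / (etaCurve γ x + 1))).fun_add
    (hy1.const_mul (ω * (etaCurve γ x + 1)))).fun_sub (hy1.const_mul (ω / (etaCurve γ x + 1)))
  have h5 := h3.unique (h4.congr_of_eventuallyEq (by
    filter_upwards [hn] with t ht
    exact hγ.phi_dot hx ht))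
  rw [h5]
  simp only [id]
  ring

theorem theta_dot_deriv (hγ : IsHamiltonSolution ω σ a b γ) {x : ℝ} (hx : x ∈ interval a b) :
    ∀ᵐ y ∂vol01, rep (deriv γ x).2.1.derH1 y = 1 / (etaCurve γ x + 1) *
      (deriv (etaCurve γ) x * ((rep (γ x).2.1.derH1 y + ω * (1 - y) - 1)
        + y * ((γ x).2.1.derH1.der y - ω)) - (γ x).1.derH1.der y) := by
  filter_upwards [rep_ae_hasDerivAt (γ x).2.1.derH1, rep_ae_hasDerivAt (γ x).1.derH1,
    ae_restrict_mem measurableSet_Ioo] with y h1 h2 hy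
  have h3 := rep_hasDerivAt (deriv γ x).2.1 hy
  have hn : Icc (0 : ℝ) 1 ∈ 𝓝 y := Icc_mem_nhds hy.1 hy.2
  have hy1 := ((hasDerivAt_id y).const_sub 1).const_mul ω
  have h4 := ((((hasDerivAt_id y).fun_mul ((h1.fun_add hy1).sub_const 1)).const_mul
    (deriv (etaCurve γ) x)).fun_sub h2).const_mul (1 / (etaCurve γ x + 1))
  have h5 := h3.unique (h4.congr_of_eventuallyEq (by
    filter_upwards [hn] with t ht
    exact hγ.theta_dot hx ht))
  rw [h5]
  simp only [id]
  ring

/-- The derivative of `z̃`, expressed through boundary values at the free surface. -/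
theorem hasDerivAt_zt (hγ : IsHamiltonSolution ω σ a b γ) {x : ℝ} (hx : x ∈ interval a b) :
    HasDerivAt (fun x => zt ω (toX1 (γ x)))
      (((rep (γ x).2.1.derH1 1 - 1) ^ 2 + rep (γ x).1.derH1 1 ^ 2) / (2 * (etaCurve γ x + 1) ^ 2)
        - 1 / 2) x := by
  have hd := hγ.hasDerivAt hx
  set g := deriv γ x with hg
  have hH : etaCurve γ x + 1 ≠ 0 := (hγ.eta_pos hx).ne'
  have hφ : HasDerivAt (fun x => mulYL (γ x).1.derH1.val) (mulYL g.1.derH1.val) x :=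
    (mulYL.comp (valL.comp derH1L)).hasFDerivAt.comp_hasDerivAt x hd.fst
  have hθ : HasDerivAt (fun x => (γ x).2.1.derH1.val + shearL2 ω) g.2.1.derH1.val x :=
    ((valL.comp derH1L).hasFDerivAt.comp_hasDerivAt x hd.snd.fst).add_const _
  have hη : HasDerivAt (fun x => (γ x).2.2.2 + 1) g.2.2.2 x := hd.snd.snd.snd.add_const _
  have hz : HasDerivAt (fun x => (γ x).2.2.1) g.2.2.1 x := hd.snd.snd.fst
  have hD := hz.fun_add ((hφ.inner ℝ hθ).fun_div hη hH)
  simp only [← zt_eq_inner] at hD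
  refine hD.congr_deriv ?_
  set H := etaCurve γ x + 1 with hHdef
  change g.2.2.1 + ((⟪mulYL (γ x).1.derH1.val, g.2.1.derH1.val⟫
    + ⟪mulYL g.1.derH1.val, (γ x).2.1.derH1.val + shearL2 ω⟫) * H
    - ⟪mulYL (γ x).1.derH1.val, (γ x).2.1.derH1.val + shearL2 ω⟫ * g.2.2.2) / H ^ 2 = _
  rw [inner_mulYL_add_shearL2, inner_mulYL_add_shearL2, inner_mulYL]
  set P := rep (γ x).1.derH1 with hP
  set Q : ℝ → ℝ := fun y => rep (γ x).2.1.derH1 y + ω * (1 - y) - 1 with hQ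
  set r := deriv (etaCurve γ) x with hr
  have hrH : r = etaH ω σ (toX1 (γ x)) := (hγ.hasDerivAt_eta hx).deriv
  have eP := rep_ae_eq (γ x).1.derH1
  have eQ := rep_ae_eq (γ x).2.1.derH1
  have eP' := rep_ae_eq g.1.derH1
  have eQ' := rep_ae_eq g.2.1.derH1
  have hPac := rep_absolutelyContinuous (γ x).1.derH1
  have hTac := rep_absolutelyContinuous (γ x).2.1.derH1
  have hQac : AbsolutelyContinuousOnInterval Q 0 1 :=
    (hTac.fun_add (absolutelyContinuous_of_contDiff (f := fun y => ω * (1 - y))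
      (by fun_prop))).fun_sub (absolutelyContinuous_of_contDiff (f := fun _ => 1) (by fun_prop))
  have hPc : ContinuousOn P (Icc 0 1) := rep_continuousOn _
  have hTc := rep_continuousOn (γ x).2.1.derH1
  have hQc : ContinuousOn Q (Icc 0 1) := by simp only [hQ]; fun_prop
  have hP'c := rep_continuousOn g.1.derH1
  have hQ'c := rep_continuousOn g.2.1.derH1
  have i1 : ∫ y, y * (γ x).1.derH1.val y * g.2.1.derH1.val y ∂vol01
      = ∫ y, y * P y * rep g.2.1.derH1 y ∂vol01 := integral_congr_ae (by
    filter_upwards [eP, eQ'] with y h1 h2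
    rw [← h1, ← h2])
  have i2 : ∫ y, y * g.1.derH1.val y * ((γ x).2.1.derH1.val y + ω * (1 - y) - 1) ∂vol01
      = ∫ y, y * rep g.1.derH1 y * Q y ∂vol01 := integral_congr_ae (by
    filter_upwards [eP', eQ] with y h1 h2
    rw [← h1, ← h2])
  have i3 : ∫ y, y * (γ x).1.derH1.val y * ((γ x).2.1.derH1.val y + ω * (1 - y) - 1) ∂vol01
      = ∫ y, y * P y * Q y ∂vol01 := integral_congr_ae (by
    filter_upwards [eP, eQ] with y h1 h2
    rw [← h1, ← h2])
  have hz' : g.2.2.1 = 1 / H ^ 2 * (∫ y, (Q y ^ 2 - P y ^ 2) / 2 ∂vol01) - 1 / 2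
      + r * (1 / H ^ 2 * ∫ y, y * P y * Q y ∂vol01) - ω * ∫ y, y * Q y ∂vol01 := by
    refine ((hγ.hamilton x hx).2.2.1).trans ?_
    rw [zH]
    have j1 : ∫ y, (1 / (2 * H ^ 2) * (((γ x).2.1.derH1.val y + ω * (1 - y) - 1) ^ 2
        - (γ x).1.derH1.val y ^ 2) - 1 / 2) ∂vol01
        = 1 / H ^ 2 * (∫ y, (Q y ^ 2 - P y ^ 2) / 2 ∂vol01) - 1 / 2 := by
      have : (1 / 2 : ℝ) = ∫ y, (1 / 2 : ℝ) ∂vol01 := by simp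
      conv_rhs => rw [this]
      rw [← integral_const_mul, ← integral_sub (Integrable.const_mul
        (integrable_of_continuousOn (by fun_prop)) _) (integrable_const _)]
      refine integral_congr_ae ?_
      filter_upwards [eP, eQ] with y h1 h2
      rw [← h1, ← h2]
      simp only [hQ, hP]
      field_simp
    have j2 : ∫ y, y * (γ x).1.derH1.val y * ((γ x).2.1.derH1.val y + ω * (1 - y) - 1) / H ^ 2
        ∂vol01 = 1 / H ^ 2 * ∫ y, y * P y * Q y ∂vol01 := by
      rw [integral_div, i3]; ring
    have j3 : ∫ y, ω * y * ((γ x).2.1.derH1.val y + ω * (1 - y) - 1) ∂vol01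
        = ω * ∫ y, y * Q y ∂vol01 := by
      rw [← integral_const_mul]
      refine integral_congr_ae ?_
      filter_upwards [eQ] with y h2
      rw [← h2]
      simp only [hQ]
      ring
    rw [← j1, ← j2, ← j3, hrH]
    rfl
  have hη' : g.2.2.2 = r := ((hγ.hamilton x hx).2.2.2).trans hrH.symm
  have key := integral_dot_eq (ω := ω) (r := r) (P := P) (P' := rep g.1.derH1)
    (Q' := rep g.2.1.derH1) hH hPac hQac (rep_ae_hasDerivAt _)
    (q := fun y => (γ x).2.1.derH1.der y - ω) (by
      filter_upwards [rep_ae_hasDerivAt (γ x).2.1.derH1] with y h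
      refine ((h.fun_add (((hasDerivAt_id y).const_sub 1).const_mul ω)).sub_const 1).congr_deriv ?_
      ring) (hγ.phi_dot_deriv hx) (hγ.theta_dot_deriv hx)
  rw [integral_add (integrable_of_continuousOn (by fun_prop))
    (integrable_of_continuousOn (by fun_prop))] at key
  rw [i1, i2, i3, hz', hη', add_comm (∫ y, y * P y * rep g.2.1.derH1 y ∂vol01), key]
  have hQ1 : rep (γ x).2.1.derH1 1 - 1 = Q 1 := by simp [hQ]
  have hb : P 1 = r * Q 1 := by
    have := (hγ.mem_dom x hx).2.2
    rw [← rep_one, ← rep_one, hQ1, sub_eq_zero] at this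
    rw [hrH, etaH]
    refine this.trans ?_
    ring
  rw [hQ1, hb]
  field_simp
  ring

theorem contDiffOn_zt (hγ : IsHamiltonSolution ω σ a b γ) :
    ContDiffOn ℝ 1 (fun x => zt ω (toX1 (γ x))) (interval a b) := by
  simp only [zt_eq_inner]
  have hd := hγ.contDiffOn
  have hφ : ContDiffOn ℝ 1 (fun x => mulYL (γ x).1.derH1.val) (interval a b) :=
    (mulYL.comp (valL.comp derH1L)).contDiff.comp_contDiffOn hd.fst
  have hθ : ContDiffOn ℝ 1 (fun x => (γ x).2.1.derH1.val + shearL2 ω) (interval a b) :=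
    ((valL.comp derH1L).contDiff.comp_contDiffOn hd.snd.fst).add contDiffOn_const
  exact hd.snd.snd.fst.add ((hφ.inner ℝ hθ).div (hd.snd.snd.snd.add contDiffOn_const)
    fun x hx => (hγ.eta_pos hx).ne')

/-- `η_x` is a smooth function of `z̃` while `|z̃| < σ`, and `z̃` is `C¹`; so `η` gains one
derivative over `γ`. -/
theorem contDiffOn_deriv_eta (hγ : IsHamiltonSolution ω σ a b γ) :
    ContDiffOn ℝ 1 (deriv (etaCurve γ)) (interval a b) := by
  have h : ContDiffOn ℝ 1 (fun x => etaH ω σ (toX1 (γ x))) (interval a b) := by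
    have hz := hγ.contDiffOn_zt
    refine hz.div ((contDiffOn_const.sub (hz.pow 2)).sqrt fun x hx =>
      (hγ.sigma_sq_sub_pos hx).ne') fun x hx => (Real.sqrt_pos.2 (hγ.sigma_sq_sub_pos hx)).ne'
  exact h.congr fun x hx => (hγ.hasDerivAt_eta hx).deriv

theorem contDiffOn_eta (hγ : IsHamiltonSolution ω σ a b γ) :
    ContDiffOn ℝ 2 (etaCurve γ) (interval a b) := by
  rw [show (2 : WithTop ℕ∞) = 1 + 1 by norm_num,
    contDiffOn_succ_iff_deriv_of_isOpen (isOpen_interval a b)]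
  exact ⟨fun x hx => (hγ.hasDerivAt_eta hx).differentiableAt.differentiableWithinAt, by simp,
    hγ.contDiffOn_deriv_eta⟩

/-- The curvature term of the Bernoulli condition. -/
theorem curvature_eq (hγ : IsHamiltonSolution ω σ a b γ) {x : ℝ} (hx : x ∈ interval a b) :
    σ * deriv (deriv (etaCurve γ)) x / (1 + deriv (etaCurve γ) x ^ 2) ^ (3 / 2 : ℝ)
      = ((rep (γ x).2.1.derH1 1 - 1) ^ 2 + rep (γ x).1.derH1 1 ^ 2) / (2 * (etaCurve γ x + 1) ^ 2)
        - 1 / 2 := by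
  have hz := hγ.hasDerivAt_zt hx
  set K := ((rep (γ x).2.1.derH1 1 - 1) ^ 2 + rep (γ x).1.derH1 1 ^ 2)
    / (2 * (etaCurve γ x + 1) ^ 2) - 1 / 2
  -- Only `z̃' = K` matters from here on: the capillary term is the derivative of `σ η_x / √(1 +
  -- η_x²) = z̃`.
  clear_value K
  have hpos := hγ.sigma_sq_sub_pos hx
  have hσ : 0 < σ := (abs_nonneg _).trans_lt (hγ.mem_dom x hx).1.2.1
  have hev : deriv (etaCurve γ) =ᶠ[𝓝 x] fun x => etaH ω σ (toX1 (γ x)) := by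
    filter_upwards [(isOpen_interval a b).mem_nhds hx] with t ht
    exact (hγ.hasDerivAt_eta ht).deriv
  have hD := hz.fun_div (((hz.fun_pow 2).const_sub (σ ^ 2)).sqrt hpos.ne')
    (Real.sqrt_pos.2 hpos).ne'
  have h2 : deriv (deriv (etaCurve γ)) x = _ := hev.deriv_eq.trans hD.deriv
  rw [h2, hev.eq_of_nhds, etaH]
  set s := zt ω (toX1 (γ x))
  have hD0 := Real.sqrt_pos.2 hpos
  have hDsq := Real.sq_sqrt hpos.le
  set D := √(σ ^ 2 - s ^ 2)
  -- With `D² = σ² - z̃²` one has `1 + η_x² = (σ/D)²`, and the fractional power becomes a cube.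
  have h3 : (1 + (s / D) ^ 2) ^ (3 / 2 : ℝ) = (σ / D) ^ 3 := by
    have : 1 + (s / D) ^ 2 = (σ / D) ^ 2 := by
      field_simp
      linarith
    rw [this, ← Real.rpow_natCast, ← Real.rpow_mul (by positivity), ← Real.rpow_natCast]
    norm_num
  rw [h3]
  field_simp
  push_cast
  linear_combination (2 * K) * hDsq

end IsHamiltonSolution

/-! ### Partial derivatives, Sobolev regularity and the Cauchy-Riemann equations in the plane -/

theorem dx_of_hasFDerivAt {f : ℝ × ℝ → ℝ} {f' : ℝ × ℝ →L[ℝ] ℝ} {p : ℝ × ℝ}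
    (h : HasFDerivAt f f' p) : dx f p = f' (1, 0) :=
  (h.comp_hasDerivAt p.1 ((hasDerivAt_id p.1).prodMk (hasDerivAt_const p.1 p.2))).deriv

theorem dy_of_hasFDerivAt {f : ℝ × ℝ → ℝ} {f' : ℝ × ℝ →L[ℝ] ℝ} {p : ℝ × ℝ}
    (h : HasFDerivAt f f' p) : dy f p = f' (0, 1) :=
  (h.comp_hasDerivAt p.2 ((hasDerivAt_const p.2 p.1).prodMk (hasDerivAt_id p.2))).deriv

theorem dx_eqOn {U : Set (ℝ × ℝ)} (hU : IsOpen U) {f g : ℝ × ℝ → ℝ} (h : EqOn f g U) :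
    EqOn (dx f) (dx g) U := by
  intro p hp
  refine Filter.EventuallyEq.deriv_eq ?_
  have hc : ContinuousAt (fun t : ℝ => (t, p.2)) p.1 := by fun_prop
  filter_upwards [hc.preimage_mem_nhds (hU.mem_nhds hp)] with t ht
  exact h ht

theorem dy_eqOn {U : Set (ℝ × ℝ)} (hU : IsOpen U) {f g : ℝ × ℝ → ℝ} (h : EqOn f g U) :
    EqOn (dy f) (dy g) U := by
  intro p hp
  refine Filter.EventuallyEq.deriv_eq ?_
  have hc : ContinuousAt (fun t : ℝ => (p.1, t)) p.2 := by fun_prop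
  filter_upwards [hc.preimage_mem_nhds (hU.mem_nhds hp)] with t ht
  exact h ht

/-! ### Smooth functions on an open set: weak derivatives and holomorphy. -/

section Smooth

variable {U : Set (ℝ × ℝ)} {f g : ℝ × ℝ → ℝ}

theorem differentiableAt_of_contDiffOn (hU : IsOpen U) (hf : ContDiffOn ℝ (⊤ : ℕ∞) f U)
    {p : ℝ × ℝ} (hp : p ∈ U) : DifferentiableAt ℝ f p :=
  (hf.contDiffAt (hU.mem_nhds hp)).differentiableAt (by simp)

theorem contDiffOn_fderiv (hU : IsOpen U) (hf : ContDiffOn ℝ (⊤ : ℕ∞) f U) (v : ℝ × ℝ) :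
    ContDiffOn ℝ (⊤ : ℕ∞) (fun p => fderiv ℝ f p v) U :=
  (hf.fderiv_of_isOpen hU (by simp)).clm_apply contDiffOn_const

theorem dx_eqOn_fderiv (hU : IsOpen U) (hf : ContDiffOn ℝ (⊤ : ℕ∞) f U) :
    EqOn (dx f) (fun p => fderiv ℝ f p (1, 0)) U := fun _ hp =>
  dx_of_hasFDerivAt (differentiableAt_of_contDiffOn hU hf hp).hasFDerivAt

theorem dy_eqOn_fderiv (hU : IsOpen U) (hf : ContDiffOn ℝ (⊤ : ℕ∞) f U) :
    EqOn (dy f) (fun p => fderiv ℝ f p (0, 1)) U := fun _ hp =>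
  dy_of_hasFDerivAt (differentiableAt_of_contDiffOn hU hf hp).hasFDerivAt

theorem contDiffOn_dx (hU : IsOpen U) (hf : ContDiffOn ℝ (⊤ : ℕ∞) f U) :
    ContDiffOn ℝ (⊤ : ℕ∞) (dx f) U :=
  (contDiffOn_fderiv hU hf _).congr (dx_eqOn_fderiv hU hf)

theorem contDiffOn_dy (hU : IsOpen U) (hf : ContDiffOn ℝ (⊤ : ℕ∞) f U) :
    ContDiffOn ℝ (⊤ : ℕ∞) (dy f) U :=
  (contDiffOn_fderiv hU hf _).congr (dy_eqOn_fderiv hU hf)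

theorem dx_dy_comm (hU : IsOpen U) (hf : ContDiffOn ℝ (⊤ : ℕ∞) f U) {p : ℝ × ℝ} (hp : p ∈ U) :
    dx (dy f) p = dy (dx f) p := by
  have hs : IsSymmSndFDerivAt ℝ f p :=
    (hf.contDiffAt (hU.mem_nhds hp)).isSymmSndFDerivAt (by
      rw [minSmoothness_of_isRCLikeNormedField]
      exact WithTop.coe_le_coe.2 (le_top : (2 : ℕ∞) ≤ ⊤))
  have hd : HasFDerivAt (fderiv ℝ f) (fderiv ℝ (fderiv ℝ f) p) p :=
    (((hf.fderiv_of_isOpen hU (m := (⊤ : ℕ∞)) (by simp)).contDiffAt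
      (hU.mem_nhds hp)).differentiableAt (by simp)).hasFDerivAt
  have hv : ∀ v : ℝ × ℝ, HasFDerivAt (fun q => fderiv ℝ f q v)
      ((fderiv ℝ (fderiv ℝ f) p).flip v) p := fun v => by
    simpa using hd.clm_apply (hasFDerivAt_const v p)
  rw [dx_eqOn hU (dy_eqOn_fderiv hU hf) hp, dy_eqOn hU (dx_eqOn_fderiv hU hf) hp,
    dx_of_hasFDerivAt (hv _), dy_of_hasFDerivAt (hv _)]
  exact hs _ _

theorem integrable_mul_of_tsupport_subset (hU : IsOpen U) (hf : ContinuousOn f U) (hg : Continuous g)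
    (hc : HasCompactSupport g) (hs : tsupport g ⊆ U) : Integrable (fun p => f p * g p) := by
  have hsupp : tsupport (fun p => f p * g p) ⊆ tsupport g :=
    closure_mono (Function.support_mul_subset_right f g)
  refine (continuous_of_tsupport fun p hp => ?_).integrable_of_hasCompactSupport (hc.mul_left)
  exact (hf.continuousAt (hU.mem_nhds (hs (hsupp hp)))).mul hg.continuousAt

/-- Integration by parts against a test function. -/
theorem integral_mul_fderiv_test (hU : IsOpen U) (hf : ContDiffOn ℝ (⊤ : ℕ∞) f U)
    {ψ : ℝ × ℝ → ℝ} (hψ : IsTest U ψ) (v : ℝ × ℝ) :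
    ∫ p in U, f p * fderiv ℝ ψ p v = -∫ p in U, fderiv ℝ f p v * ψ p := by
  obtain ⟨h1, h2, h3⟩ := hψ
  have hd : Continuous (fun p => fderiv ℝ ψ p v) :=
    (h1.continuous_fderiv (by simp)).clm_apply continuous_const
  have hds : tsupport (fun p => fderiv ℝ ψ p v) ⊆ tsupport ψ := tsupport_fderiv_apply_subset ℝ v
  have hdc : HasCompactSupport (fun p => fderiv ℝ ψ p v) := h2.fderiv_apply ℝ v
  have z1 : ∀ p ∉ U, f p * fderiv ℝ ψ p v = 0 := fun p hp => by
    rw [image_eq_zero_of_notMem_tsupport (f := fun p => fderiv ℝ ψ p v)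
      (fun h => hp (h3 (hds h))), mul_zero]
  have z2 : ∀ p ∉ U, fderiv ℝ f p v * ψ p = 0 := fun p hp => by
    rw [image_eq_zero_of_notMem_tsupport (fun h => hp (h3 h)), mul_zero]
  -- Both integrands vanish off `U`, so the integrals extend to the plane, where `f` needs to be
  -- differentiable only on the support of `ψ`.
  rw [setIntegral_eq_integral_of_forall_compl_eq_zero z1,
    setIntegral_eq_integral_of_forall_compl_eq_zero z2]
  have := integral_bilinear_hasFDerivAt_right_eq_neg_left_of_integrable (μ := volume)
    (f := f) (f' := fderiv ℝ f) (g := ψ) (g' := fderiv ℝ ψ) (v := v)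
    (B := ContinuousLinearMap.mul ℝ ℝ)
    (integrable_mul_of_tsupport_subset hU (contDiffOn_fderiv hU hf v).continuousOn h1.continuous
      h2 h3)
    (integrable_mul_of_tsupport_subset hU hf.continuousOn hd hdc (hds.trans h3))
    (integrable_mul_of_tsupport_subset hU hf.continuousOn h1.continuous h2 h3)
    (fun p hp => (differentiableAt_of_contDiffOn hU hf (h3 hp)).hasFDerivAt)
    (fun p _ => (h1.differentiable (by simp) p).hasFDerivAt)
  simpa using this

theorem weak_partial (hU : IsOpen U) (hf : ContDiffOn ℝ (⊤ : ℕ∞) f U) {ψ : ℝ × ℝ → ℝ}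
    (hψ : IsTest U ψ) :
    ∫ p in U, f p * dx ψ p = -∫ p in U, dx f p * ψ p ∧
      ∫ p in U, f p * dy ψ p = -∫ p in U, dy f p * ψ p := by
  have h1 := hψ.1.contDiffOn (s := U)
  constructor
  · rw [setIntegral_congr_fun hU.measurableSet
        (fun p hp => congrArg (f p * ·) (dx_eqOn_fderiv hU h1 hp)),
      setIntegral_congr_fun hU.measurableSet
        (fun p hp => congrArg (· * ψ p) (dx_eqOn_fderiv hU hf hp))]
    exact integral_mul_fderiv_test hU hf hψ _
  · rw [setIntegral_congr_fun hU.measurableSet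
        (fun p hp => congrArg (f p * ·) (dy_eqOn_fderiv hU h1 hp)),
      setIntegral_congr_fun hU.measurableSet
        (fun p hp => congrArg (· * ψ p) (dy_eqOn_fderiv hU hf hp))]
    exact integral_mul_fderiv_test hU hf hψ _

/-- Classical derivatives serve as weak ones, and symmetry of second derivatives spares one mixed
estimate. -/
theorem memH_two_of_contDiffOn (hU : IsOpen U) (hf : ContDiffOn ℝ (⊤ : ℕ∞) f U)
    (h : MemLp f 2 (volume.restrict U)) (hx : MemLp (dx f) 2 (volume.restrict U))
    (hy : MemLp (dy f) 2 (volume.restrict U)) (hxx : MemLp (dx (dx f)) 2 (volume.restrict U))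
    (hxy : MemLp (dy (dx f)) 2 (volume.restrict U)) (hyy : MemLp (dy (dy f)) 2 (volume.restrict U)) :
    MemH U 2 f := by
  have hyx : MemLp (dx (dy f)) 2 (volume.restrict U) := by
    refine (memLp_congr_ae ?_).2 hxy
    filter_upwards [ae_restrict_mem hU.measurableSet] with p hp
    exact dx_dy_comm hU hf hp
  exact ⟨h, dx f, dy f,
    ⟨hx, dx (dx f), dy (dx f), hxx, hxy, fun ψ hψ => weak_partial hU (contDiffOn_dx hU hf) hψ⟩,
    ⟨hy, dx (dy f), dy (dy f), hyx, hyy, fun ψ hψ => weak_partial hU (contDiffOn_dy hU hf) hψ⟩,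
    fun ψ hψ => weak_partial hU hf hψ⟩

/-- Differentiable functions that satisfy the Cauchy-Riemann equations are smooth. -/
theorem contDiffOn_of_cauchyRiemann (hU : IsOpen U) (hf : ∀ p ∈ U, DifferentiableAt ℝ f p)
    (hg : ∀ p ∈ U, DifferentiableAt ℝ g p) (h1 : ∀ p ∈ U, dx f p = dy g p)
    (h2 : ∀ p ∈ U, dy f p = -dx g p) :
    ContDiffOn ℝ (⊤ : ℕ∞) f U ∧ ContDiffOn ℝ (⊤ : ℕ∞) g U := by
  set e : ℂ ≃L[ℝ] ℝ × ℝ := Complex.equivRealProdCLM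
  -- Real differentiability plus Cauchy-Riemann makes `f + i g` holomorphic, hence smooth; `f` and
  -- `g` are its real and imaginary parts.
  let F : ℂ → ℂ := fun z => (f (e z) : ℂ) + (g (e z) : ℂ) * Complex.I
  have hV : IsOpen (e ⁻¹' U) := hU.preimage e.continuous
  have hF : DifferentiableOn ℂ F (e ⁻¹' U) := by
    intro z hz
    have hf' := (Complex.ofRealCLM.hasFDerivAt.comp z
      (((hf _ hz).hasFDerivAt).comp z e.hasFDerivAt))
    have hg' := (Complex.ofRealCLM.hasFDerivAt.comp z
      (((hg _ hz).hasFDerivAt).comp z e.hasFDerivAt))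
    have hd : HasFDerivAt F _ z := hf'.add (hg'.mul_const Complex.I)
    refine (DifferentiableAt.differentiableWithinAt ?_)
    rw [differentiableAt_complex_iff_differentiableAt_real]
    refine ⟨hd.differentiableAt, ?_⟩
    have a1 := h1 _ hz
    have a2 := h2 _ hz
    rw [dx_of_hasFDerivAt (hf _ hz).hasFDerivAt, dy_of_hasFDerivAt (hg _ hz).hasFDerivAt] at a1
    rw [dy_of_hasFDerivAt (hf _ hz).hasFDerivAt, dx_of_hasFDerivAt (hg _ hz).hasFDerivAt] at a2
    have e1 : e 1 = (1, 0) := by simp [e]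
    have eI : e Complex.I = (0, 1) := by simp [e]
    rw [hd.fderiv]
    simp only [add_apply, ContinuousLinearMap.comp_apply, smul_apply, smul_eq_mul,
      ContinuousLinearEquiv.coe_coe, e1, eI, Complex.ofRealCLM_apply]
    rw [a1, a2]
    push_cast
    linear_combination (-(fderiv ℝ g (e z) (1, 0) : ℂ)) * Complex.I_mul_I
  have hC : ContDiffOn ℝ (⊤ : ℕ∞) F (e ⁻¹' U) :=
    (hF.contDiffOn (n := (⊤ : ℕ∞)) hV).restrict_scalars ℝ
  have hC' : ContDiffOn ℝ (⊤ : ℕ∞) (fun p => F (e.symm p)) U :=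
    hC.comp e.symm.contDiff.contDiffOn fun p hp => by simpa using hp
  constructor
  · refine (Complex.reCLM.contDiff.comp_contDiffOn hC').congr fun p _ => ?_
    simp [F]
  · refine (Complex.imCLM.contDiff.comp_contDiffOn hC').congr fun p _ => ?_
    simp [F]

end Smooth

/-! ### Square integrability over the fluid domain -/

theorem lintegral_sq_L2 (u : L2) : ∫⁻ y, ‖u y‖ₑ ^ 2 ∂vol01 = ‖u‖ₑ ^ 2 := by
  rw [Lp.enorm_def, eLpNorm_eq_lintegral_rpow_enorm_toReal (by norm_num) (by norm_num)]
  simp only [ENNReal.toReal_ofNat, ENNReal.rpow_ofNat]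
  rw [← ENNReal.rpow_natCast, ← ENNReal.rpow_mul]
  norm_num

theorem lintegral_Ioo_affine {H : ℝ} (hH : 0 < H) (F : ℝ → ENNReal) :
    ∫⁻ y in Ioo (-1) (H - 1), F y = ENNReal.ofReal H * ∫⁻ s, F (H * s - 1) ∂vol01 := by
  have himg : (fun s => H * s - 1) '' Ioo (0 : ℝ) 1 = Ioo (-1) (H - 1) := by
    ext y
    simp only [mem_image, mem_Ioo]
    constructor
    · rintro ⟨s, hs, rfl⟩
      constructor <;> nlinarith [hs.1, hs.2]
    · intro hy
      refine ⟨(y + 1) / H, ⟨div_pos (by linarith) hH, (div_lt_one hH).2 (by linarith)⟩, ?_⟩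
      field_simp
      ring
  rw [← himg, lintegral_image_eq_lintegral_abs_deriv_mul (f' := fun _ => H) measurableSet_Ioo
    (fun s _ => ?_) (fun s _ t _ hst => ?_), lintegral_const_mul' _ _ ENNReal.ofReal_ne_top,
    abs_of_pos hH]
  · have := ((hasDerivAt_id s).const_mul H).sub_const 1
    simpa using this.hasDerivWithinAt
  · have : H * s = H * t := by simpa using hst
    exact mul_left_cancel₀ hH.ne' this

theorem isOpen_fluid {x₁ x₂ : ℝ} {η : ℝ → ℝ} (hη : ContinuousOn η (Ioo x₁ x₂)) :
    IsOpen (fluid x₁ x₂ η) := by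
  have h1 : IsOpen {p : ℝ × ℝ | p.1 ∈ Ioo x₁ x₂} := isOpen_Ioo.preimage continuous_fst
  have h2 : ContinuousOn (fun p : ℝ × ℝ => η p.1 - p.2) {p : ℝ × ℝ | p.1 ∈ Ioo x₁ x₂} :=
    (hη.comp continuousOn_fst fun p hp => hp).sub continuousOn_snd
  have h3 := h2.isOpen_inter_preimage h1 (isOpen_Ioi (a := (0 : ℝ)))
  have h4 : IsOpen {p : ℝ × ℝ | -1 < p.2} := isOpen_Ioi.preimage continuous_snd
  convert! h3.inter h4 using 1
  ext p
  simp only [fluid, mem_ofPred_eq, mem_inter_iff, mem_preimage, mem_Ioi, sub_pos]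
  tauto

/-- By Tonelli and an affine change of variable, the slice at `x` contributes `(η x + 1) ‖k x‖²`,
which is bounded on the compact interval `[x₁, x₂]`. -/
theorem memLp_fluid {x₁ x₂ : ℝ} {η : ℝ → ℝ} (hη : ContinuousOn η (Icc x₁ x₂))
    (hpos : ∀ x ∈ Icc x₁ x₂, 0 < η x + 1) {F : ℝ × ℝ → ℝ} (hF : ContinuousOn F (fluid x₁ x₂ η))
    {k : ℝ → L2} (hk : ContinuousOn k (Icc x₁ x₂))
    (h : ∀ x ∈ Ioo x₁ x₂, ∀ᵐ s ∂vol01, F (x, (η x + 1) * s - 1) = k x s) :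
    MemLp F 2 (volume.restrict (fluid x₁ x₂ η)) := by
  have hopen := isOpen_fluid (hη.mono Ioo_subset_Icc_self)
  have hmeas := hopen.measurableSet
  have hFm : AEStronglyMeasurable F (volume.restrict (fluid x₁ x₂ η)) :=
    hF.aestronglyMeasurable hmeas
  obtain ⟨C₁, hC₁⟩ := isCompact_Icc.exists_bound_of_continuousOn hη
  obtain ⟨C₂, hC₂⟩ := isCompact_Icc.exists_bound_of_continuousOn hk
  refine ⟨hFm, ?_⟩
  rw [eLpNorm_lt_top_iff_lintegral_rpow_enorm_lt_top (by norm_num) (by norm_num)]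
  simp only [ENNReal.toReal_ofNat, ENNReal.rpow_ofNat]
  set G : ℝ × ℝ → ENNReal := (fluid x₁ x₂ η).indicator fun p => ‖F p‖ₑ ^ 2 with hG
  have hGm : AEMeasurable G volume := by
    rw [hG, aemeasurable_indicator_iff hmeas]
    exact hFm.enorm.pow_const 2
  rw [← lintegral_indicator hmeas, Measure.volume_eq_prod, lintegral_prod _ hGm]
  have hin : ∀ x, ∫⁻ y, G (x, y) ≤
      (Ioo x₁ x₂).indicator (fun _ => ENNReal.ofReal (C₁ + 1) * ENNReal.ofReal C₂ ^ 2) x := by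
    intro x
    by_cases hx : x ∈ Ioo x₁ x₂
    · rw [indicator_of_mem hx]
      have hx' := Ioo_subset_Icc_self hx
      have e1 : ∀ y, G (x, y) = (Ioo (-1) (η x + 1 - 1)).indicator (fun y => ‖F (x, y)‖ₑ ^ 2) y := by
        intro y
        simp only [hG, indicator, fluid, mem_ofPred_eq, mem_Ioo, hx.1, hx.2, and_self, true_and,
           add_sub_cancel_right]
      simp only [e1]
      rw [lintegral_indicator measurableSet_Ioo, lintegral_Ioo_affine (hpos x hx')]
      refine mul_le_mul' (ENNReal.ofReal_le_ofReal ?_) ?_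
      · linarith [(le_abs_self _).trans (hC₁ x hx')]
      · rw [lintegral_congr_ae ((h x hx).mono fun s hs => by rw [hs]), lintegral_sq_L2]
        gcongr
        rw [← ofReal_norm]
        exact ENNReal.ofReal_le_ofReal (hC₂ x hx')
    · rw [indicator_of_notMem hx]
      refine le_of_eq ?_
      rw [lintegral_eq_zero_of_ae_eq_zero]
      refine Eventually.of_forall fun y => ?_
      exact indicator_of_notMem (fun hp => hx hp.1) _
  refine (lintegral_mono hin).trans_lt ?_
  rw [lintegral_indicator measurableSet_Ioo, lintegral_const]
  refine ENNReal.mul_lt_top (ENNReal.mul_lt_top ENNReal.ofReal_lt_top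
    (ENNReal.pow_lt_top ENNReal.ofReal_lt_top)) ?_
  simp

/-- In the flattened variable each function to be estimated directly is a continuous multiple of one
`L²` curve plus a polynomial of degree at most two, which carries the shear and the explicit terms.
-/
theorem memLp_fluid_of_quadratic {x₁ x₂ : ℝ} {η : ℝ → ℝ} (hη : ContinuousOn η (Icc x₁ x₂))
    (hpos : ∀ x ∈ Icc x₁ x₂, 0 < η x + 1) {F : ℝ × ℝ → ℝ} (hF : ContinuousOn F (fluid x₁ x₂ η))
    {k : ℝ → L2} {c c₀ c₁ c₂ : ℝ → ℝ} (hk : ContinuousOn k (Icc x₁ x₂))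
    (hc : ContinuousOn c (Icc x₁ x₂)) (hc₀ : ContinuousOn c₀ (Icc x₁ x₂))
    (hc₁ : ContinuousOn c₁ (Icc x₁ x₂)) (hc₂ : ContinuousOn c₂ (Icc x₁ x₂))
    (h : ∀ x ∈ Ioo x₁ x₂, ∀ᵐ s ∂vol01,
      F (x, (η x + 1) * s - 1) = c x * k x s + (c₀ x + c₁ x * s + c₂ x * s ^ 2)) :
    MemLp F 2 (volume.restrict (fluid x₁ x₂ η)) := by
  let e₀ := contL2 (fun _ => 1) continuous_const
  let e₁ := contL2 (fun y => y) continuous_id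
  let e₂ := contL2 (fun y => y ^ 2) (by fun_prop)
  refine memLp_fluid hη hpos hF (k := fun x => c x • k x + (c₀ x • e₀ + c₁ x • e₁ + c₂ x • e₂))
    ((hc.smul hk).add (((hc₀.smul continuousOn_const).add (hc₁.smul continuousOn_const)).add
      (hc₂.smul continuousOn_const))) fun x hx => ?_
  filter_upwards [h x hx, Lp.coeFn_add (c x • k x) (c₀ x • e₀ + c₁ x • e₁ + c₂ x • e₂),
    Lp.coeFn_add (c₀ x • e₀ + c₁ x • e₁) (c₂ x • e₂), Lp.coeFn_add (c₀ x • e₀) (c₁ x • e₁),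
    Lp.coeFn_smul (c x) (k x), Lp.coeFn_smul (c₀ x) e₀, Lp.coeFn_smul (c₁ x) e₁,
    Lp.coeFn_smul (c₂ x) e₂, contL2_ae_eq (fun _ => 1) continuous_const,
    contL2_ae_eq (fun y => y) continuous_id, contL2_ae_eq (fun y => y ^ 2) (by fun_prop)]
    with s a0 a1 a2 a3 a4 a5 a6 a7 a8 a9 a10
  rw [a0, a1, Pi.add_apply, a2, Pi.add_apply, a3, Pi.add_apply, a4, a5, a6, a7]
  simp only [Pi.smul_apply, smul_eq_mul, e₀, e₁, e₂, a8, a9, a10, mul_one]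

theorem laplace_of_cauchyRiemann {U : Set (ℝ × ℝ)} {f g : ℝ × ℝ → ℝ} (hU : IsOpen U)
    (hg : ContDiffOn ℝ (⊤ : ℕ∞) g U) (h1 : ∀ p ∈ U, dx f p = dy g p)
    (h2 : ∀ p ∈ U, dy f p = -dx g p) {p : ℝ × ℝ} (hp : p ∈ U) :
    dx (dx f) p + dy (dy f) p = 0 := by
  rw [dx_eqOn hU h1 hp, dy_eqOn hU h2 hp, dx_dy_comm hU hg hp]
  have : dy (fun p => -dx g p) p = -dy (dx g) p := by simp [dy]
  rw [this, add_neg_cancel]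

/-! ### The velocity field -/

/-- The horizontal velocity `φ_x`. -/
def velX (ω : ℝ) (γ : ℝ → X2) (p : ℝ × ℝ) : ℝ :=
  (rep (γ p.1).2.1.derH1 (ybar (etaCurve γ) p) + ω * (1 - ybar (etaCurve γ) p) - 1)
    / (etaCurve γ p.1 + 1) + ω * p.2 + 1

/-- The vertical velocity `φ_y`. -/
def velY (γ : ℝ → X2) (p : ℝ × ℝ) : ℝ :=
  rep (γ p.1).1.derH1 (ybar (etaCurve γ) p) / (etaCurve γ p.1 + 1)

theorem ybar_affine {η : ℝ → ℝ} {x : ℝ} (h : 0 < η x + 1) (s : ℝ) :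
    ybar η (x, (η x + 1) * s - 1) = s := by
  simp only [ybar]
  field_simp
  ring

theorem ybar_mem_Icc {η : ℝ → ℝ} {p : ℝ × ℝ} (h : 0 < η p.1 + 1) (h1 : -1 ≤ p.2) (h2 : p.2 ≤ η p.1) :
    ybar η p ∈ Icc (0 : ℝ) 1 :=
  ⟨div_nonneg (by linarith) h.le, (div_le_one h).2 (by linarith)⟩

theorem ybar_mem_Ioo {η : ℝ → ℝ} {p : ℝ × ℝ} (h : 0 < η p.1 + 1) (h1 : -1 < p.2) (h2 : p.2 < η p.1) :
    ybar η p ∈ Ioo (0 : ℝ) 1 :=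
  ⟨div_pos (by linarith) h, (div_lt_one h).2 (by linarith)⟩

theorem hasDerivAt_ybar_left {η : ℝ → ℝ} {η' : ℝ} {p : ℝ × ℝ} (h : 0 < η p.1 + 1)
    (hη : HasDerivAt η η' p.1) :
    HasDerivAt (fun t => ybar η (t, p.2)) (-(ybar η p * η' / (η p.1 + 1))) p.1 := by
  have := (hasDerivAt_const p.1 (p.2 + 1)).fun_div (hη.add_const 1) h.ne'
  refine this.congr_deriv ?_
  simp only [ybar]
  field_simp
  ring

theorem hasDerivAt_ybar_right (η : ℝ → ℝ) (p : ℝ × ℝ) :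
    HasDerivAt (fun t => ybar η (p.1, t)) (1 / (η p.1 + 1)) p.2 := by
  have := ((hasDerivAt_id p.2).add_const 1).div_const (η p.1 + 1)
  exact this

theorem differentiableAt_ybar {η : ℝ → ℝ} {p : ℝ × ℝ} (h : 0 < η p.1 + 1)
    (hη : DifferentiableAt ℝ η p.1) : DifferentiableAt ℝ (ybar η) p := by
  have h1 : DifferentiableAt ℝ (fun p : ℝ × ℝ => p.2 + 1) p := differentiableAt_snd.add_const 1
  have h2 : DifferentiableAt ℝ (fun p : ℝ × ℝ => η p.1 + 1) p :=
    (DifferentiableAt.comp p hη differentiableAt_fst).add_const 1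
  have h3 : DifferentiableAt ℝ (fun p : ℝ × ℝ => (p.2 + 1) * (η p.1 + 1)⁻¹) p :=
    h1.fun_mul (h2.fun_inv h.ne')
  simp only [← div_eq_mul_inv] at h3
  exact h3

/-! ### Regularity along the curve up to the closed strip. -/

namespace IsHamiltonSolution

variable {ω σ : ℝ} {a b : EReal} {γ : ℝ → X2}

theorem continuousOn_eta (hγ : IsHamiltonSolution ω σ a b γ) :
    ContinuousOn (etaCurve γ) (interval a b) := hγ.contDiffOn_eta.continuousOn

theorem continuousOn_phi (hγ : IsHamiltonSolution ω σ a b γ) :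
    ContinuousOn (fun x => (γ x).1) (interval a b) := continuous_fst.comp_continuousOn hγ.continuousOn

theorem continuousOn_theta (hγ : IsHamiltonSolution ω σ a b γ) :
    ContinuousOn (fun x => (γ x).2.1) (interval a b) :=
  (continuous_fst.comp continuous_snd).comp_continuousOn hγ.continuousOn

theorem phiCurve_continuousOn (hγ : IsHamiltonSolution ω σ a b γ) :
    ContinuousOn (fun p : ℝ × ℝ => phiCurve γ p.1 p.2) (interval a b ×ˢ Icc (0 : ℝ) 1) :=
  rep_continuousOn_prod (w := fun x => (γ x).1.toH1)
    (toH1L.continuous.comp_continuousOn hγ.continuousOn_phi)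

theorem thetaCurve_continuousOn (hγ : IsHamiltonSolution ω σ a b γ) :
    ContinuousOn (fun p : ℝ × ℝ => thetaCurve γ p.1 p.2) (interval a b ×ˢ Icc (0 : ℝ) 1) :=
  rep_continuousOn_prod (w := fun x => (γ x).2.1.toH1)
    (toH1L.continuous.comp_continuousOn hγ.continuousOn_theta)

theorem hasFDerivAt_phiCurve (hγ : IsHamiltonSolution ω σ a b γ) {x y : ℝ} (hx : x ∈ interval a b)
    (hy : y ∈ Ioo (0 : ℝ) 1) :
    HasFDerivAt (fun p : ℝ × ℝ => phiCurve γ p.1 p.2)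
      ((ContinuousLinearMap.toSpanSingleton ℝ (rep (deriv γ x).1.toH1 y)).coprod
        (ContinuousLinearMap.toSpanSingleton ℝ (rep (γ x).1.derH1 y))) (x, y) :=
  hasFDerivAt_rep (isOpen_interval a b) (w := fun x => (γ x).1) (w' := fun x => (deriv γ x).1) hx hy
    (fun _ ht => (hγ.hasDerivAt ht).fst) hγ.continuousOn_deriv.fst

theorem hasFDerivAt_thetaCurve (hγ : IsHamiltonSolution ω σ a b γ) {x y : ℝ}
    (hx : x ∈ interval a b) (hy : y ∈ Ioo (0 : ℝ) 1) :
    HasFDerivAt (fun p : ℝ × ℝ => thetaCurve γ p.1 p.2)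
      ((ContinuousLinearMap.toSpanSingleton ℝ (rep (deriv γ x).2.1.toH1 y)).coprod
        (ContinuousLinearMap.toSpanSingleton ℝ (rep (γ x).2.1.derH1 y))) (x, y) :=
  hasFDerivAt_rep (isOpen_interval a b) (w := fun x => (γ x).2.1) (w' := fun x => (deriv γ x).2.1)
    hx hy (fun _ ht => (hγ.hasDerivAt ht).snd.fst) hγ.continuousOn_deriv.snd.fst

/-- The part of the potential that depends on `x` only. -/
theorem hasDerivAt_primitive (hγ : IsHamiltonSolution ω σ a b γ) {x₁ x : ℝ}
    (hx₁ : x₁ ∈ interval a b) (hx : x ∈ interval a b) :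
    HasDerivAt (fun x => (2 - ω) / 2 * (x - x₁) + ∫ s in x₁..x,
        (deriv (etaCurve γ) s / (etaCurve γ s + 1) * phiCurve γ s 1 + ω / 2 * etaCurve γ s
          + (ω - 2) / (2 * (etaCurve γ s + 1))))
      ((2 - ω) / 2 + (deriv (etaCurve γ) x / (etaCurve γ x + 1) * phiCurve γ x 1
        + ω / 2 * etaCurve γ x + (ω - 2) / (2 * (etaCurve γ x + 1)))) x := by
  have hg : ContinuousOn (fun s => deriv (etaCurve γ) s / (etaCurve γ s + 1) * phiCurve γ s 1
      + ω / 2 * etaCurve γ s + (ω - 2) / (2 * (etaCurve γ s + 1))) (interval a b) := by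
    have h1 := hγ.continuousOn_eta
    have h2 := hγ.contDiffOn_deriv_eta.continuousOn
    have h3 : ContinuousOn (fun s => phiCurve γ s 1) (interval a b) :=
      hγ.phiCurve_continuousOn.comp (f := fun s : ℝ => (s, (1 : ℝ))) (by fun_prop)
        fun s hs => ⟨hs, by simp⟩
    refine (((h2.div (h1.add continuousOn_const) fun s hs => (hγ.eta_pos hs).ne').mul h3).add
      (continuousOn_const.mul h1)).add (continuousOn_const.div
        (continuousOn_const.mul (h1.add continuousOn_const)) fun s hs => ?_)
    exact (mul_pos two_pos (hγ.eta_pos hs)).ne'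
  have hconv : uIcc x₁ x ⊆ interval a b := by
    rcases le_total x₁ x with h | h
    · rw [uIcc_of_le h]; exact Icc_subset_interval hx₁.1 hx.2
    · rw [uIcc_of_ge h]; exact Icc_subset_interval hx.1 hx₁.2
  have h1 := ((hasDerivAt_id x).sub_const x₁).const_mul ((2 - ω) / 2)
  rw [mul_one] at h1
  exact h1.fun_add (intervalIntegral.integral_hasDerivAt_right (hg.mono hconv).intervalIntegrable
    (hg.stronglyMeasurableAtFilter (isOpen_interval a b) x hx)
    (hg.continuousAt ((isOpen_interval a b).mem_nhds hx)))

theorem potential_eq (ω x₁ : ℝ) (γ : ℝ → X2) (p : ℝ × ℝ) :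
    potential ω x₁ γ p = phiCurve γ p.1 (ybar (etaCurve γ) p) + ((2 - ω) / 2 * (p.1 - x₁)
      + ∫ s in x₁..p.1,
        (deriv (etaCurve γ) s / (etaCurve γ s + 1) * phiCurve γ s 1 + ω / 2 * etaCurve γ s
          + (ω - 2) / (2 * (etaCurve γ s + 1)))) := add_assoc _ _ _

/-! ### Gradients of the potential and the stream function. -/

section Derivatives

variable {x₁ : ℝ} {p : ℝ × ℝ}

theorem differentiableAt_potential (hγ : IsHamiltonSolution ω σ a b γ) (hx₁ : x₁ ∈ interval a b)
    (hp : p.1 ∈ interval a b) (hy : ybar (etaCurve γ) p ∈ Ioo (0 : ℝ) 1) :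
    DifferentiableAt ℝ (potential ω x₁ γ) p := by
  have h1 := (hγ.hasFDerivAt_phiCurve hp hy).differentiableAt
  have h2 := differentiableAt_ybar (hγ.eta_pos hp) (hγ.hasDerivAt_eta hp).differentiableAt
  have h3 := (hγ.hasDerivAt_primitive hx₁ hp).differentiableAt
  have h4 : DifferentiableAt ℝ (fun p : ℝ × ℝ => (p.1, ybar (etaCurve γ) p)) p :=
    differentiableAt_fst.prodMk h2
  simp only [funext (potential_eq ω x₁ γ)]
  exact (DifferentiableAt.comp p h1 h4).fun_add (DifferentiableAt.comp p h3 differentiableAt_fst)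

theorem differentiableAt_stream (hγ : IsHamiltonSolution ω σ a b γ)
    (hp : p.1 ∈ interval a b) (hy : ybar (etaCurve γ) p ∈ Ioo (0 : ℝ) 1) :
    DifferentiableAt ℝ (stream ω γ) p := by
  have h1 := (hγ.hasFDerivAt_thetaCurve hp hy).differentiableAt
  have h2 := differentiableAt_ybar (hγ.eta_pos hp) (hγ.hasDerivAt_eta hp).differentiableAt
  have h4 : DifferentiableAt ℝ (fun p : ℝ × ℝ => (p.1, ybar (etaCurve γ) p)) p :=
    differentiableAt_fst.prodMk h2
  have h5 : DifferentiableAt ℝ (fun p : ℝ × ℝ => etaCurve γ p.1) p :=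
    (hγ.hasDerivAt_eta hp).differentiableAt.comp p differentiableAt_fst
  exact ((DifferentiableAt.comp p h1 h4).fun_sub
    (((h2.const_sub 1).fun_pow 2).const_mul (ω / 2))).fun_add (h2.fun_mul h5)

/-- The `ȳ_x φ_y` term of the chain rule cancels `η_x ȳ φ_y / (η + 1)` in Hamilton's equation. The
added primitive removes `η_x φ(1) / (η + 1)` and adjusts the terms that depend on `x` only. -/
theorem dx_potential (hγ : IsHamiltonSolution ω σ a b γ) (hx₁ : x₁ ∈ interval a b)
    (hp : p.1 ∈ interval a b) (hy : ybar (etaCurve γ) p ∈ Ioo (0 : ℝ) 1) :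
    dx (potential ω x₁ γ) p = velX ω γ p := by
  have hH := hγ.eta_pos hp
  have h2 := hasDerivAt_ybar_left hH (hγ.hasDerivAt_eta hp)
  have h1 := (hγ.hasFDerivAt_phiCurve hp hy).comp_hasDerivAt p.1 ((hasDerivAt_id p.1).prodMk h2)
  have h3 := h1.fun_add (hγ.hasDerivAt_primitive hx₁ hp)
  simp only [dx, potential_eq]
  refine h3.deriv.trans ?_
  simp only [ContinuousLinearMap.coprod_apply, ContinuousLinearMap.toSpanSingleton_apply,
    smul_eq_mul, one_mul, hγ.phi_dot hp (Ioo_subset_Icc_self hy), velX,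
    (hγ.hasDerivAt_eta hp).deriv]
  have hy2 : p.2 = ybar (etaCurve γ) p * (etaCurve γ p.1 + 1) - 1 := by
    simp only [ybar]; field_simp; ring
  rw [hy2]
  field_simp
  ring

theorem dy_potential (hγ : IsHamiltonSolution ω σ a b γ)
    (hp : p.1 ∈ interval a b) (hy : ybar (etaCurve γ) p ∈ Ioo (0 : ℝ) 1) :
    dy (potential ω x₁ γ) p = velY γ p := by
  have h2 := hasDerivAt_ybar_right (etaCurve γ) p
  have h1 := (hγ.hasFDerivAt_phiCurve hp hy).comp_hasDerivAt p.2
    ((hasDerivAt_const p.2 p.1).prodMk h2)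
  simp only [dy, potential_eq]
  refine (h1.add_const _).deriv.trans ?_
  simp only [ContinuousLinearMap.coprod_apply, ContinuousLinearMap.toSpanSingleton_apply,
    smul_eq_mul, velY]
  ring

theorem dx_stream (hγ : IsHamiltonSolution ω σ a b γ)
    (hp : p.1 ∈ interval a b) (hy : ybar (etaCurve γ) p ∈ Ioo (0 : ℝ) 1) :
    dx (stream ω γ) p = -velY γ p := by
  have hH := hγ.eta_pos hp
  have hη := hγ.hasDerivAt_eta hp
  have h2 := hasDerivAt_ybar_left hH hη
  have h1 := (hγ.hasFDerivAt_thetaCurve hp hy).comp_hasDerivAt p.1 ((hasDerivAt_id p.1).prodMk h2)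
  have h3 := (h1.fun_sub (((h2.const_sub 1).fun_pow 2).const_mul (ω / 2))).fun_add (h2.fun_mul hη)
  refine h3.deriv.trans ?_
  simp only [ContinuousLinearMap.coprod_apply, ContinuousLinearMap.toSpanSingleton_apply,
    smul_eq_mul, one_mul, hγ.theta_dot hp (Ioo_subset_Icc_self hy), velY, hη.deriv, Prod.mk.eta]
  push_cast
  field_simp
  ring

theorem dy_stream (hγ : IsHamiltonSolution ω σ a b γ)
    (hp : p.1 ∈ interval a b) (hy : ybar (etaCurve γ) p ∈ Ioo (0 : ℝ) 1) :
    dy (stream ω γ) p = velX ω γ p - ω * p.2 := by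
  have hH := hγ.eta_pos hp
  have h2 := hasDerivAt_ybar_right (etaCurve γ) p
  have h1 := (hγ.hasFDerivAt_thetaCurve hp hy).comp_hasDerivAt p.2
    ((hasDerivAt_const p.2 p.1).prodMk h2)
  have h3 := (h1.fun_sub (((h2.const_sub 1).fun_pow 2).const_mul (ω / 2))).fun_add
    (h2.mul_const (etaCurve γ p.1))
  refine h3.deriv.trans ?_
  simp only [ContinuousLinearMap.coprod_apply, ContinuousLinearMap.toSpanSingleton_apply,
    smul_eq_mul, velX, Prod.mk.eta]
  push_cast
  field_simp
  ring

end Derivatives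

/-- On a vertical line `φ_y` is only absolutely continuous, so its derivative is identified a.e.;
square integrability needs no more. -/
theorem dy_velY_ae (hγ : IsHamiltonSolution ω σ a b γ) {x : ℝ} (hx : x ∈ interval a b) :
    ∀ᵐ s ∂vol01, dy (velY γ) (x, (etaCurve γ x + 1) * s - 1)
      = 1 / (etaCurve γ x + 1) ^ 2 * (γ x).1.derH1.der s := by
  have hH := hγ.eta_pos hx
  filter_upwards [rep_ae_hasDerivAt (γ x).1.derH1] with s hs
  have h2 := hasDerivAt_ybar_right (etaCurve γ) (x, (etaCurve γ x + 1) * s - 1)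
  rw [← ybar_affine hH s] at hs
  have h3 := (HasDerivAt.comp (h := fun t => ybar (etaCurve γ) (x, t)) _ hs h2).div_const (etaCurve γ x + 1)
  refine h3.deriv.trans ?_
  rw [ybar_affine hH s]
  field_simp

theorem dy_velX_ae (hγ : IsHamiltonSolution ω σ a b γ) {x : ℝ} (hx : x ∈ interval a b) :
    ∀ᵐ s ∂vol01, dy (velX ω γ) (x, (etaCurve γ x + 1) * s - 1)
      = 1 / (etaCurve γ x + 1) ^ 2 * (γ x).2.1.derH1.der s
        + (ω - ω / (etaCurve γ x + 1) ^ 2) := by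
  have hH := hγ.eta_pos hx
  filter_upwards [rep_ae_hasDerivAt (γ x).2.1.derH1] with s hs
  have h2 := hasDerivAt_ybar_right (etaCurve γ) (x, (etaCurve γ x + 1) * s - 1)
  rw [← ybar_affine hH s] at hs
  have h3 := (((((HasDerivAt.comp (h := fun t => ybar (etaCurve γ) (x, t)) _ hs h2).fun_add ((h2.const_sub 1).const_mul ω)).sub_const
    1).div_const (etaCurve γ x + 1)).fun_add
    ((hasDerivAt_id ((etaCurve γ x + 1) * s - 1)).const_mul ω)).add_const 1
  refine h3.deriv.trans ?_
  rw [ybar_affine hH s]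
  field_simp
  ring

theorem continuousOn_velocity (hγ : IsHamiltonSolution ω σ a b γ) {x₁ x₂ : ℝ}
    (hI : Icc x₁ x₂ ⊆ interval a b) :
    ContinuousOn (velX ω γ) (fluidBar x₁ x₂ (etaCurve γ)) ∧
      ContinuousOn (velY γ) (fluidBar x₁ x₂ (etaCurve γ)) := by
  have hmem : ∀ p ∈ fluidBar x₁ x₂ (etaCurve γ), p.1 ∈ interval a b := fun p hp =>
    hI (Ioo_subset_Icc_self hp.1)
  have hη : ContinuousOn (fun p : ℝ × ℝ => etaCurve γ p.1 + 1) (fluidBar x₁ x₂ (etaCurve γ)) :=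
    (hγ.continuousOn_eta.comp continuousOn_fst hmem).add continuousOn_const
  have hne : ∀ p ∈ fluidBar x₁ x₂ (etaCurve γ), etaCurve γ p.1 + 1 ≠ 0 := fun p hp =>
    (hγ.eta_pos (hmem p hp)).ne'
  have hyb : ContinuousOn (ybar (etaCurve γ)) (fluidBar x₁ x₂ (etaCurve γ)) :=
    (continuousOn_snd.add continuousOn_const).div hη hne
  have hmap : MapsTo (fun p : ℝ × ℝ => (p.1, ybar (etaCurve γ) p)) (fluidBar x₁ x₂ (etaCurve γ))
      (interval a b ×ˢ Icc (0 : ℝ) 1) := fun p hp =>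
    ⟨hmem p hp, ybar_mem_Icc (hγ.eta_pos (hmem p hp)) hp.2.1 hp.2.2⟩
  have hP := (rep_continuousOn_prod (w := fun x => (γ x).1.derH1)
    (derH1L.continuous.comp_continuousOn hγ.continuousOn_phi)).comp
    (continuousOn_fst.prodMk hyb) hmap
  have hT := (rep_continuousOn_prod (w := fun x => (γ x).2.1.derH1)
    (derH1L.continuous.comp_continuousOn hγ.continuousOn_theta)).comp
    (continuousOn_fst.prodMk hyb) hmap
  exact ⟨((((hT.add (continuousOn_const.mul (continuousOn_const.sub hyb))).sub
    continuousOn_const).div hη hne).add (continuousOn_const.mul continuousOn_snd)).add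
    continuousOn_const, hP.div hη hne⟩

/-- The boundary condition `φ_y(1) = η_x (θ_y(1) - 1)`. -/
theorem phi_boundary (hγ : IsHamiltonSolution ω σ a b γ) {x : ℝ} (hx : x ∈ interval a b) :
    rep (γ x).1.derH1 1 = deriv (etaCurve γ) x * (rep (γ x).2.1.derH1 1 - 1) := by
  have := (hγ.mem_dom x hx).2.2
  rw [← rep_one, ← rep_one, sub_eq_zero] at this
  rw [(hγ.hasDerivAt_eta hx).deriv, etaH]
  refine this.trans ?_
  ring

end IsHamiltonSolution

/-! ### Smoothness, Sobolev regularity and the free-boundary problem over `(x₁, x₂)`. -/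

namespace IsHamiltonSolution

variable {ω σ : ℝ} {a b : EReal} {γ : ℝ → X2} {x₁ x₂ : ℝ}

theorem isOpen_fluid (hγ : IsHamiltonSolution ω σ a b γ) (hI : Icc x₁ x₂ ⊆ interval a b) :
    IsOpen (fluid x₁ x₂ (etaCurve γ)) :=
  CapillaryWave.isOpen_fluid (hγ.continuousOn_eta.mono (Ioo_subset_Icc_self.trans hI))

theorem mem_of_fluid (hγ : IsHamiltonSolution ω σ a b γ) (hI : Icc x₁ x₂ ⊆ interval a b)
    {p : ℝ × ℝ} (hp : p ∈ fluid x₁ x₂ (etaCurve γ)) :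
    p.1 ∈ interval a b ∧ ybar (etaCurve γ) p ∈ Ioo (0 : ℝ) 1 :=
  have h := hI (Ioo_subset_Icc_self hp.1)
  ⟨h, ybar_mem_Ioo (hγ.eta_pos h) hp.2.1 hp.2.2⟩

theorem affine_mem_fluid (hγ : IsHamiltonSolution ω σ a b γ) (hI : Icc x₁ x₂ ⊆ interval a b)
    {x s : ℝ} (hx : x ∈ Ioo x₁ x₂) (hs : s ∈ Ioo (0 : ℝ) 1) :
    (x, (etaCurve γ x + 1) * s - 1) ∈ fluid x₁ x₂ (etaCurve γ) := by
  have hH := hγ.eta_pos (hI (Ioo_subset_Icc_self hx))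
  refine ⟨hx, ?_, ?_⟩
  · have := mul_pos hH hs.1
    change -1 < (etaCurve γ x + 1) * s - 1
    linarith
  · have := mul_lt_mul_of_pos_left hs.2 hH
    change (etaCurve γ x + 1) * s - 1 < etaCurve γ x
    linarith

theorem smooth (hγ : IsHamiltonSolution ω σ a b γ) (hI : Icc x₁ x₂ ⊆ interval a b)
    (h₁ : x₁ ∈ interval a b) :
    ContDiffOn ℝ (⊤ : ℕ∞) (potential ω x₁ γ) (fluid x₁ x₂ (etaCurve γ)) ∧
    ContDiffOn ℝ (⊤ : ℕ∞) (stream ω γ) (fluid x₁ x₂ (etaCurve γ)) ∧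
    ∀ p ∈ fluid x₁ x₂ (etaCurve γ),
      dx (dx (potential ω x₁ γ)) p + dy (dy (potential ω x₁ γ)) p = 0 := by
  have hU := hγ.isOpen_fluid hI
  -- Adding `ω y²/2` to the stream function absorbs the vorticity and leaves the homogeneous
  -- Cauchy-Riemann equations.
  have hq : ContDiff ℝ (⊤ : ℕ∞) (fun p : ℝ × ℝ => ω / 2 * p.2 ^ 2) := by fun_prop
  have hf : ∀ p ∈ fluid x₁ x₂ (etaCurve γ), DifferentiableAt ℝ (potential ω x₁ γ) p :=
    fun p hp => hγ.differentiableAt_potential h₁ (hγ.mem_of_fluid hI hp).1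
      (hγ.mem_of_fluid hI hp).2
  have hs : ∀ p ∈ fluid x₁ x₂ (etaCurve γ), DifferentiableAt ℝ (stream ω γ) p :=
    fun p hp => hγ.differentiableAt_stream (hγ.mem_of_fluid hI hp).1 (hγ.mem_of_fluid hI hp).2
  have hg : ∀ p ∈ fluid x₁ x₂ (etaCurve γ),
      DifferentiableAt ℝ (fun p => stream ω γ p + ω / 2 * p.2 ^ 2) p :=
    fun p hp => (hs p hp).fun_add (hq.differentiable (by simp) p)
  have hdx : ∀ p : ℝ × ℝ,
      dx (fun p => stream ω γ p + ω / 2 * p.2 ^ 2) p = dx (stream ω γ) p := fun p => by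
    simp [dx]
  have hdy : ∀ p ∈ fluid x₁ x₂ (etaCurve γ),
      dy (fun p => stream ω γ p + ω / 2 * p.2 ^ 2) p = dy (stream ω γ) p + ω * p.2 := by
    intro p hp
    have h1 : DifferentiableAt ℝ (fun t => stream ω γ (p.1, t)) p.2 :=
      DifferentiableAt.comp (g := stream ω γ) p.2 (hs p hp)
        ((differentiableAt_const p.1).prodMk differentiableAt_id)
    refine (h1.hasDerivAt.fun_add (((hasDerivAt_id p.2).fun_pow 2).const_mul (ω / 2))).deriv.trans ?_
    simp only [dy, id]
    push_cast
    ring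
  have c1 : ∀ p ∈ fluid x₁ x₂ (etaCurve γ), dx (potential ω x₁ γ) p
      = dy (fun p => stream ω γ p + ω / 2 * p.2 ^ 2) p := fun p hp => by
    obtain ⟨hp1, hp2⟩ := hγ.mem_of_fluid hI hp
    rw [hdy p hp, hγ.dx_potential h₁ hp1 hp2, hγ.dy_stream hp1 hp2, sub_add_cancel]
  have c2 : ∀ p ∈ fluid x₁ x₂ (etaCurve γ), dy (potential ω x₁ γ) p
      = -dx (fun p => stream ω γ p + ω / 2 * p.2 ^ 2) p := fun p hp => by
    obtain ⟨hp1, hp2⟩ := hγ.mem_of_fluid hI hp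
    rw [hdx p, hγ.dy_potential hp1 hp2, hγ.dx_stream hp1 hp2, neg_neg]
  obtain ⟨s1, s2⟩ := contDiffOn_of_cauchyRiemann hU hf hg c1 c2
  refine ⟨s1, (s2.sub hq.contDiffOn).congr fun p _ => by simp, fun p hp =>
    laplace_of_cauchyRiemann hU s2 c1 c2 hp⟩

theorem memH (hγ : IsHamiltonSolution ω σ a b γ) (hI : Icc x₁ x₂ ⊆ interval a b)
    (h₁ : x₁ ∈ interval a b) :
    MemH (fluid x₁ x₂ (etaCurve γ)) 2 (potential ω x₁ γ) ∧
      MemH (fluid x₁ x₂ (etaCurve γ)) 2 (stream ω γ) := by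
  have hU := hγ.isOpen_fluid hI
  obtain ⟨s1, s2, hlap⟩ := hγ.smooth hI h₁
  have hη : ContinuousOn (etaCurve γ) (Icc x₁ x₂) := hγ.continuousOn_eta.mono hI
  have hpos : ∀ x ∈ Icc x₁ x₂, 0 < etaCurve γ x + 1 := fun x hx => hγ.eta_pos (hI hx)
  have hI' : ∀ x ∈ Ioo x₁ x₂, x ∈ interval a b := fun x hx => hI (Ioo_subset_Icc_self hx)
  have hcH : ContinuousOn (fun x => etaCurve γ x + 1) (Icc x₁ x₂) := hη.add continuousOn_const
  have hcH1 : ContinuousOn (fun x => 1 / (etaCurve γ x + 1)) (Icc x₁ x₂) :=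
    continuousOn_const.div hcH fun x hx => (hpos x hx).ne'
  have hcH2 : ContinuousOn (fun x => 1 / (etaCurve γ x + 1) ^ 2) (Icc x₁ x₂) :=
    continuousOn_const.div (hcH.pow 2) fun x hx => (pow_pos (hpos x hx) 2).ne'
  have hkφ (A : H2 →L[ℝ] L2) : ContinuousOn (fun x => A (γ x).1) (Icc x₁ x₂) :=
    A.continuous.comp_continuousOn (hγ.continuousOn_phi.mono hI)
  have hkθ (A : H2 →L[ℝ] L2) : ContinuousOn (fun x => A (γ x).2.1) (Icc x₁ x₂) :=
    A.continuous.comp_continuousOn (hγ.continuousOn_theta.mono hI)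
  have eX : EqOn (dx (potential ω x₁ γ)) (velX ω γ) (fluid x₁ x₂ (etaCurve γ)) := fun p hp =>
    hγ.dx_potential h₁ (hγ.mem_of_fluid hI hp).1 (hγ.mem_of_fluid hI hp).2
  have eY : EqOn (dy (potential ω x₁ γ)) (velY γ) (fluid x₁ x₂ (etaCurve γ)) := fun p hp =>
    hγ.dy_potential (hγ.mem_of_fluid hI hp).1 (hγ.mem_of_fluid hI hp).2
  have cr : EqOn (dx (stream ω γ)) (fun p => -dy (potential ω x₁ γ) p)
      (fluid x₁ x₂ (etaCurve γ)) := fun p hp => by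
    simp only [eY hp]
    exact hγ.dx_stream (hγ.mem_of_fluid hI hp).1 (hγ.mem_of_fluid hI hp).2
  have cr' : EqOn (dy (stream ω γ)) (fun p => dx (potential ω x₁ γ) p - ω * p.2)
      (fluid x₁ x₂ (etaCurve γ)) := fun p hp => by
    simp only [eX hp]
    exact hγ.dy_stream (hγ.mem_of_fluid hI hp).1 (hγ.mem_of_fluid hI hp).2
  have congr_neg {F G : ℝ × ℝ → ℝ} (h : EqOn F (fun p => -G p) (fluid x₁ x₂ (etaCurve γ)))
      (hG : MemLp G 2 (volume.restrict (fluid x₁ x₂ (etaCurve γ)))) :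
      MemLp F 2 (volume.restrict (fluid x₁ x₂ (etaCurve γ))) := by
    refine (memLp_congr_ae ?_).2 hG.neg
    filter_upwards [ae_restrict_mem hU.measurableSet] with p hp
    exact h hp
  have m0 : MemLp (potential ω x₁ γ) 2 (volume.restrict (fluid x₁ x₂ (etaCurve γ))) := by
    refine memLp_fluid_of_quadratic hη hpos s1.continuousOn (hkφ (valL.comp toH1L))
      (c := fun _ => 1) (c₁ := fun _ => 0) (c₂ := fun _ => 0) continuousOn_const
      (fun x hx => (hγ.hasDerivAt_primitive (x₁ := x₁) h₁
        (hI hx)).continuousAt.continuousWithinAt) continuousOn_const continuousOn_const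
      fun x hx => ?_
    filter_upwards [rep_ae_eq (γ x).1.toH1] with s hs
    rw [potential_eq, ybar_affine (hγ.eta_pos (hI' x hx)), phiCurve, hs]
    simp
  have mx : MemLp (dx (potential ω x₁ γ)) 2 (volume.restrict (fluid x₁ x₂ (etaCurve γ))) := by
    refine memLp_fluid_of_quadratic hη hpos (contDiffOn_dx hU s1).continuousOn
      (hkθ (valL.comp derH1L))
      (c₀ := fun x => (ω - 1) * (1 / (etaCurve γ x + 1)) + (1 - ω))
      (c₁ := fun x => -ω * (1 / (etaCurve γ x + 1)) + ω * (etaCurve γ x + 1))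
      (c₂ := fun _ => 0) hcH1
      ((continuousOn_const.mul hcH1).add continuousOn_const)
      ((continuousOn_const.mul hcH1).add (continuousOn_const.mul hcH)) continuousOn_const
      fun x hx => ?_
    filter_upwards [rep_ae_eq (γ x).2.1.derH1, ae_restrict_mem measurableSet_Ioo] with s hs hs'
    rw [eX (hγ.affine_mem_fluid hI hx hs'), velX, ybar_affine (hγ.eta_pos (hI' x hx))]
    simp only [hs, ContinuousLinearMap.comp_apply, valL_apply, derH1L_apply]
    ring
  have my : MemLp (dy (potential ω x₁ γ)) 2 (volume.restrict (fluid x₁ x₂ (etaCurve γ))) := by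
    refine memLp_fluid_of_quadratic hη hpos (contDiffOn_dy hU s1).continuousOn
      (hkφ (valL.comp derH1L)) (c₀ := fun _ => 0) (c₁ := fun _ => 0) (c₂ := fun _ => 0) hcH1
      continuousOn_const continuousOn_const continuousOn_const fun x hx => ?_
    filter_upwards [rep_ae_eq (γ x).1.derH1, ae_restrict_mem measurableSet_Ioo] with s hs hs'
    rw [eY (hγ.affine_mem_fluid hI hx hs'), velY, ybar_affine (hγ.eta_pos (hI' x hx))]
    simp only [hs, ContinuousLinearMap.comp_apply, valL_apply, derH1L_apply]
    ring
  have mxy : MemLp (dy (dx (potential ω x₁ γ))) 2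
      (volume.restrict (fluid x₁ x₂ (etaCurve γ))) := by
    refine memLp_fluid_of_quadratic hη hpos (contDiffOn_dy hU (contDiffOn_dx hU s1)).continuousOn
      (hkθ (derL.comp derH1L)) (c₀ := fun x => ω - ω * (1 / (etaCurve γ x + 1) ^ 2))
      (c₁ := fun _ => 0) (c₂ := fun _ => 0) hcH2
      (continuousOn_const.sub (continuousOn_const.mul hcH2)) continuousOn_const continuousOn_const
      fun x hx => ?_
    filter_upwards [hγ.dy_velX_ae (hI' x hx), ae_restrict_mem measurableSet_Ioo] with s hs hs'
    rw [dy_eqOn hU eX (hγ.affine_mem_fluid hI hx hs'), hs]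
    simp only [ContinuousLinearMap.comp_apply, derL_apply, derH1L_apply]
    ring
  have myy : MemLp (dy (dy (potential ω x₁ γ))) 2
      (volume.restrict (fluid x₁ x₂ (etaCurve γ))) := by
    refine memLp_fluid_of_quadratic hη hpos (contDiffOn_dy hU (contDiffOn_dy hU s1)).continuousOn
      (hkφ (derL.comp derH1L)) (c₀ := fun _ => 0) (c₁ := fun _ => 0) (c₂ := fun _ => 0) hcH2
      continuousOn_const continuousOn_const continuousOn_const fun x hx => ?_
    filter_upwards [hγ.dy_velY_ae (hI' x hx), ae_restrict_mem measurableSet_Ioo] with s hs hs'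
    rw [dy_eqOn hU eY (hγ.affine_mem_fluid hI hx hs'), hs]
    simp only [ContinuousLinearMap.comp_apply, derL_apply, derH1L_apply]
    ring
  have n0 : MemLp (stream ω γ) 2 (volume.restrict (fluid x₁ x₂ (etaCurve γ))) := by
    refine memLp_fluid_of_quadratic hη hpos s2.continuousOn (hkθ (valL.comp toH1L))
      (c := fun _ => 1) (c₀ := fun _ => -(ω / 2)) (c₁ := fun x => ω + etaCurve γ x)
      (c₂ := fun _ => -(ω / 2)) continuousOn_const continuousOn_const
      (continuousOn_const.add hη) continuousOn_const fun x hx => ?_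
    filter_upwards [rep_ae_eq (γ x).2.1.toH1] with s hs
    rw [stream, ybar_affine (hγ.eta_pos (hI' x hx)), thetaCurve, hs]
    simp only [ContinuousLinearMap.comp_apply, valL_apply, toH1L_apply]
    ring
  have mY : MemLp (fun p : ℝ × ℝ => ω * p.2) 2 (volume.restrict (fluid x₁ x₂ (etaCurve γ))) := by
    refine memLp_fluid_of_quadratic hη hpos (by fun_prop) (k := fun _ => 0) (c := fun _ => 0)
      (c₀ := fun _ => -ω) (c₁ := fun x => ω * (etaCurve γ x + 1)) (c₂ := fun _ => 0)
      continuousOn_const continuousOn_const continuousOn_const (continuousOn_const.mul hcH)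
      continuousOn_const fun x _ => Eventually.of_forall fun s => ?_
    simp only
    ring
  have mω : MemLp (fun _ : ℝ × ℝ => ω) 2 (volume.restrict (fluid x₁ x₂ (etaCurve γ))) := by
    refine memLp_fluid_of_quadratic hη hpos (by fun_prop) (k := fun _ => 0) (c := fun _ => 0)
      (c₀ := fun _ => ω) (c₁ := fun _ => 0) (c₂ := fun _ => 0)
      continuousOn_const continuousOn_const continuousOn_const continuousOn_const
      continuousOn_const fun x _ => Eventually.of_forall fun s => ?_
    ring
  have hneg : ∀ (F : ℝ × ℝ → ℝ) (p : ℝ × ℝ), dx (fun p => -F p) p = -dx F p ∧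
      dy (fun p => -F p) p = -dy F p := fun F p => by simp [dx, dy]
  refine ⟨memH_two_of_contDiffOn hU s1 m0 mx my ?_ mxy myy,
    memH_two_of_contDiffOn hU s2 n0 (congr_neg cr my) ?_ ?_ ?_ ?_⟩
  -- The curve is only once differentiable in `x`, so `φ_xx` is taken from the Laplace equation.
  · exact congr_neg (fun p hp => eq_neg_of_add_eq_zero_left (hlap p hp)) myy
  · refine (memLp_congr_ae ?_).2 (mx.sub mY)
    filter_upwards [ae_restrict_mem hU.measurableSet] with p hp
    exact cr' hp
  · refine congr_neg (fun p hp => ?_) mxy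
    rw [dx_eqOn hU cr hp, (hneg _ p).1, dx_dy_comm hU s1 hp]
  · refine congr_neg (fun p hp => ?_) myy
    rw [dy_eqOn hU cr hp, (hneg _ p).2]
  · refine (memLp_congr_ae ?_).2 (mxy.sub mω)
    filter_upwards [ae_restrict_mem hU.measurableSet] with p hp
    rw [dy_eqOn hU cr' hp]
    have h1 : DifferentiableAt ℝ (fun t => dx (potential ω x₁ γ) (p.1, t)) p.2 :=
      DifferentiableAt.comp (g := dx (potential ω x₁ γ)) p.2
        (differentiableAt_of_contDiffOn hU (contDiffOn_dx hU s1) hp)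
        ((differentiableAt_const p.1).prodMk differentiableAt_id)
    refine (h1.hasDerivAt.fun_sub ((hasDerivAt_id p.2).const_mul ω)).deriv.trans ?_
    simp [dy]

theorem isTravellingWave (hγ : IsHamiltonSolution ω σ a b γ) (hI : Icc x₁ x₂ ⊆ interval a b)
    (h₁ : x₁ ∈ interval a b) :
    IsTravellingWave ω σ x₁ x₂ (potential ω x₁ γ) (etaCurve γ) := by
  obtain ⟨s1, -, hlap⟩ := hγ.smooth hI h₁
  obtain ⟨cX, cY⟩ := hγ.continuousOn_velocity hI
  refine ⟨s1, hlap, hγ.contDiffOn_eta.mono (Ioo_subset_Icc_self.trans hI), velX ω γ, velY γ, cX, cY,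
    fun p hp => (hγ.dx_potential h₁ (hγ.mem_of_fluid hI hp).1 (hγ.mem_of_fluid hI hp).2).symm,
    fun p hp => (hγ.dy_potential (hγ.mem_of_fluid hI hp).1 (hγ.mem_of_fluid hI hp).2).symm,
    fun x hx => ?_⟩
  have hx' := hI (Ioo_subset_Icc_self hx)
  have hH := hγ.eta_pos hx'
  have hy0 : ybar (etaCurve γ) (x, -1) = 0 := by simp [ybar]
  have hy1 : ybar (etaCurve γ) (x, etaCurve γ x) = 1 := div_self hH.ne'
  have hb := hγ.phi_boundary hx'
  refine ⟨?_, ?_, ?_⟩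
  · have h0 : trace0 (γ x).1.derH1 = 0 := (hγ.mem_dom x hx').2.1
    simp only [velY, hy0, rep_zero, h0, zero_div]
  · simp only [velX, velY, hy1, hb]
    field_simp
    ring
  -- The remaining terms of Bernoulli's law are `½ (u - 1 - ω η)² + ½ v² - ½`, and `u - 1 - ω η =
  -- (θ_y(1) - 1) / (η + 1)` on the surface.
  · rw [hγ.curvature_eq hx']
    simp only [velX, velY, hy1]
    field_simp
    ring

end IsHamiltonSolution

end CapillaryWave

end

theorem mainTheorem2 (ω σ : ℝ) (a b : EReal) (γ : ℝ → CapillaryWave.X2)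
    (hγ : CapillaryWave.IsHamiltonSolution ω σ a b γ) :
    -- `phiCurve γ`, `thetaCurve γ` are jointly continuous representatives of the components of `γ`
    (∀ x ∈ CapillaryWave.interval a b,
      CapillaryWave.phiCurve γ x =ᵐ[CapillaryWave.vol01] (γ x).1.toH1.val ∧
      CapillaryWave.thetaCurve γ x =ᵐ[CapillaryWave.vol01] (γ x).2.1.toH1.val) ∧
    ContinuousOn (fun p : ℝ × ℝ => CapillaryWave.phiCurve γ p.1 p.2)
      (CapillaryWave.interval a b ×ˢ Set.Icc (0 : ℝ) 1) ∧
    ContinuousOn (fun p : ℝ × ℝ => CapillaryWave.thetaCurve γ p.1 p.2)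
      (CapillaryWave.interval a b ×ˢ Set.Icc (0 : ℝ) 1) ∧
    ∀ x₁ x₂ : ℝ, a < x₁ → x₁ < x₂ → x₂ < b →
      let η := CapillaryWave.etaCurve γ
      let Θ := CapillaryWave.fluid x₁ x₂ η
      let φ := CapillaryWave.potential ω x₁ γ
      let ζ := CapillaryWave.stream ω γ
      CapillaryWave.MemH Θ 2 φ ∧ CapillaryWave.MemH Θ 2 ζ ∧
      ContDiffOn ℝ (⊤ : ℕ∞) φ Θ ∧ ContDiffOn ℝ (⊤ : ℕ∞) ζ Θ ∧
      (∀ p ∈ Θ,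
        CapillaryWave.dx φ p = CapillaryWave.dy ζ p + ω * p.2 ∧
        CapillaryWave.dy φ p = -CapillaryWave.dx ζ p) ∧
      CapillaryWave.IsTravellingWave ω σ x₁ x₂ φ η := by
  refine ⟨fun x _ => ⟨CapillaryWave.rep_ae_eq _, CapillaryWave.rep_ae_eq _⟩,
    hγ.phiCurve_continuousOn, hγ.thetaCurve_continuousOn, fun x₁ x₂ ha h12 hb => ?_⟩
  intro η Θ φ ζ
  have hI := CapillaryWave.Icc_subset_interval ha hb
  have h₁ : x₁ ∈ CapillaryWave.interval a b := hI (left_mem_Icc.2 h12.le)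
  obtain ⟨m1, m2⟩ := hγ.memH hI h₁
  obtain ⟨s1, s2, -⟩ := hγ.smooth hI h₁
  refine ⟨m1, m2, s1, s2, fun p hp => ?_, hγ.isTravellingWave hI h₁⟩
  obtain ⟨hp1, hp2⟩ := hγ.mem_of_fluid hI hp
  refine ⟨?_, ?_⟩
  · rw [hγ.dx_potential h₁ hp1 hp2, hγ.dy_stream hp1 hp2, sub_add_cancel]
  · rw [hγ.dy_potential hp1 hp2, hγ.dx_stream hp1 hp2, neg_neg]
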